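/- **Setting.** Points of the square are pairs of infinite binary expansions; a *basic dyadic rectangle* $I\times J$ is a product of two basic dyadic intervals (all expansions with a given finite prefix). The group $2V$ consists of the bijections $f$ of the square for which the square is filled by finitely many basic dyadic rectangles, each mapped by $f$ affinely (by exchanging prefixes) onto a basic dyadic rectangle. A *vertical* (resp. *horizontal*) caret of a binary tree halves a rectangle by a vertical (resp. horizontal) segment; leaves are numbered $0,1,2,\dots$ from left to right; the *spine* of a tree is its right side. Maps act on the right, so products are read from left to right. A *grid tree-pair diagram* consists of a tree $T_v$ of vertical carets and a tree $T_h$ of horizontal carets, and of a target subdivision of the square obtained by repeated halving, whose rectangles are matched with those of the source grid, i.e. with the leaves of the tree $T$ obtained by hanging a copy of $T_h$ from each leaf of $T_v$. It represents $f$ if $f$ maps every source rectangle affinely onto the matching target rectangle. It is *reduced* if for every exposed caret of $T_v$, with leaves the two halves of $I$, there is a leaf $J$ of $T_h$ such that $f$ does not map $I\times J$ affinely onto a basic dyadic rectangle, and likewise with the roles of $T_v$ and $T_h$ exchanged. For a tree $S$ with $k$ carets let $[S]\in 2V$ be the element that maps the leaves of $S$, in order, to the leaves of the all-right tree $R_k$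 with $k$ vertical carets. Let $A_i$ (resp. $B_i$) be $[S]$ for $S=R_{i+1}$ with a vertical (resp. horizontal) caret attached at leaf $i$; let $C_i$ be $[S]$ for the all-right tree $S$ with carets $0,\dots,i$ of which only caret $i$ is horizontal; let $\Pi_i$, $\overline{\Pi}_i$ interchange the leaves $i,i+1$ of $R_{i+2}$, resp. $R_{i+1}$. **Theorem.** Every $f\in 2V$ has a unique reduced grid tree-pair diagram, and this diagram gives rise to a unique positive prefix word in the letters $A_i,B_j,C_k$, as follows. Let $T_v$ have $n+1$ leaves and $T_h$ have $m+1$ leaves, let $i$ and $s$ be the numbers of carets on the spines of $T_v$ and $T_h$, let $a_j$ and $b_p$ be the lengths of the maximal paths of left edges going up from leaf $j$ of $T_v$, resp. leaf $p$ of $T_h$, and not reaching the spine, and let $b'_p$ be the length of the maximal path of left edges going up from leaf $p$ of $T_h$. Then: 1. $[T_v]=A_0^{a_0}A_1^{a_1}\cdots A_n^{a_n}$, and the exponents $a_0,\dots,a_n$ are unique with this property. 2. (On the spine) $[T_h]=C_0C_1\cdots C_{s-1}\,B_0^{b_0}B_1^{b_1}\cdots B_m^{b_m}$, and the exponents $b_p$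 are unique with this property. 3. (Off the spine) for the tree $T_h'$ obtained by hanging $T_h$ from the left leaf of a vertical caret, $[T_h']=B_0^{b'_0}B_1^{b'_1}\cdots B_m^{b'_m}$, and the exponents $b'_p$ are unique with this property. 4. For every $p$, $b'_p=b_p$ or $b'_p=b_p+1$. 5. For the full tree $T$ of the source grid, $$[T]=P:=C_iC_{i+1}\cdots C_{i+s-1}\;\Bigl(\prod_{j=0}^{n-1}A_{(m+1)j}^{a_j}B_{(m+1)j}^{b'_0}B_{(m+1)j+1}^{b'_1}\cdots B_{(m+1)j+m}^{b'_m}\Bigr)\;A_{(m+1)n}^{a_n}B_{(m+1)n}^{b_0}B_{(m+1)n+1}^{b_1}\cdots B_{(m+1)n+m}^{b_m}$$ (with no letters $C$ if $m=0$), and $P$ is the only word of this type, with arbitrary values of $i$, $s$ and of the exponents, that represents $[T]$. 6. For every tree $S$ whose leaves are the rectangles of the target subdivision, $f=P\,\Pi\,N^{-1}$, where $\Pi$ is a word in the letters $\Pi_i,\overline{\Pi}_i$ that permutes the leaves of the all-right tree with as many leaves as $S$, and $N$ is a positive word representing $[S]$, consisting of letters $C_k$ with increasing indices followed by letters $A_k,B_k$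 with nondecreasing indices. -/

import Mathlib

namespace Thompson2V

/-! ### The Cantor square and the group `2V` -/

/-- The square, as the product of two Cantor sets of infinite binary expansions. The first
coordinate is the horizontal position (`false` is the left half, `true` the right half), the second
one the vertical position (`false` is the half that belongs to the left leaf of a horizontal
caret, `true` the other half). -/
abbrev Square : Type := Stream' Bool × Stream' Bool

/-- A basic dyadic rectangle `I × J`: a finite word names the basic dyadic interval of all
expansions that start with this word. -/
abbrev Rect : Type := List Bool × List Bool

/-- The point of the rectangle `r` with relative position `z`. Thus `r.place` is the affine
identification of the square with `r`, and its range is the set of points of `r`. -/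
def Rect.place (r : Rect) (z : Square) : Square :=
  (Stream'.appendStream' r.1 z.1, Stream'.appendStream' r.2 z.2)

/-- `f` maps the basic dyadic rectangle `r` affinely onto the basic dyadic rectangle `r'`. -/
def MapsRect (f : Equiv.Perm Square) (r r' : Rect) : Prop :=
  ∀ z : Square, f (Rect.place r z) = Rect.place r' z

/-- `f` is affine on each of finitely many basic dyadic rectangles that fill the square, with basic
dyadic rectangles as images. -/
def IsDyadic (f : Equiv.Perm Square) : Prop :=
  ∃ s : Finset Rect, (∀ z : Square, ∃ r ∈ s, z ∈ Set.range (Rect.place r)) ∧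
    ∀ r ∈ s, ∃ r' : Rect, MapsRect f r r'

theorem place_append (r : Rect) (u v : List Bool) (z : Square) :
    Rect.place (r.1 ++ u, r.2 ++ v) z = Rect.place r (Rect.place (u, v) z) := by
  simp [Rect.place]

theorem exists_append_of_stream {p q : List Bool} {x y : Stream' Bool}
    (h : Stream'.appendStream' p x = Stream'.appendStream' q y) (hl : p.length ≤ q.length) :
    ∃ w, q = p ++ w := by
  induction p generalizing q with
  | nil => exact ⟨q, rfl⟩
  | cons a p ih =>
    cases q with
    | nil => simp at hl
    | cons b q =>
      simp only [Stream'.cons_append_stream] at h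
      have h' := Stream'.cons_injective2 h
      obtain ⟨w, hw⟩ := ih h'.2 (by simpa using hl)
      exact ⟨w, by simp [h'.1, hw]⟩

theorem isDyadic_one : IsDyadic 1 :=
  ⟨{([], [])}, fun z => ⟨_, Finset.mem_singleton_self _, z, rfl⟩, fun r _ => ⟨r, fun _ => rfl⟩⟩

theorem IsDyadic.inv {f : Equiv.Perm Square} (hf : IsDyadic f) : IsDyadic f⁻¹ := by
  classical
  obtain ⟨s, hs, hm⟩ := hf
  choose! g hg using hm
  refine ⟨s.image g, fun z => ?_, fun r hr => ?_⟩
  · obtain ⟨r, hr, y, hy⟩ := hs (f⁻¹ z)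
    refine ⟨g r, Finset.mem_image_of_mem g hr, y, ?_⟩
    rw [← hg r hr y, hy]; exact f.apply_symm_apply z
  · obtain ⟨r, hr0, rfl⟩ := Finset.mem_image.1 hr
    exact ⟨r, fun z => by rw [← hg r hr0 z]; exact f.symm_apply_apply _⟩

theorem IsDyadic.mul {f g : Equiv.Perm Square} (hf : IsDyadic f) (hg : IsDyadic g) :
    IsDyadic (f * g) := by
  classical
  obtain ⟨t, ht, hft⟩ := hf
  obtain ⟨s, hs, hgs⟩ := hg
  let N : ℕ := t.sup fun r => max r.1.length r.2.length
  let W : Finset (List Bool) := Finset.univ.image (List.ofFn : (Fin N → Bool) → List Bool)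
  have hW : ∀ u, u ∈ W ↔ u.length = N := by
    intro u
    constructor
    · intro hu
      obtain ⟨k, -, rfl⟩ := Finset.mem_image.1 hu
      simp
    · intro hu
      refine Finset.mem_image.2 ⟨fun i => u.get (Fin.cast hu.symm i), Finset.mem_univ _, ?_⟩
      apply List.ext_get <;> simp [hu]
  refine ⟨(s ×ˢ W ×ˢ W).image fun x => (x.1.1 ++ x.2.1, x.1.2 ++ x.2.2), fun z => ?_,
    fun r hr => ?_⟩
  · obtain ⟨r, hr, y, rfl⟩ := hs z
    refine ⟨(r.1 ++ y.1.take N, r.2 ++ y.2.take N), Finset.mem_image.2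
      ⟨(r, y.1.take N, y.2.take N), ?_, rfl⟩, (y.1.drop N, y.2.drop N), ?_⟩
    · simp [hr, hW, Stream'.length_take]
    · rw [place_append]
      simp [Rect.place, Stream'.append_take_drop]
  · obtain ⟨⟨r, u, v⟩, hx, rfl⟩ := Finset.mem_image.1 hr
    simp only [Finset.mem_product, hW] at hx
    obtain ⟨hr, hu, hv⟩ := hx
    obtain ⟨r', hr'⟩ := hgs r hr
    let z₀ : Square := (Stream'.const false, Stream'.const false)
    obtain ⟨q, hq, y, hy⟩ := ht (Rect.place (r'.1 ++ u, r'.2 ++ v) z₀)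
    obtain ⟨q', hq'⟩ := hft q hq
    have hN : max q.1.length q.2.length ≤ N :=
      Finset.le_sup (f := fun r : Rect => max r.1.length r.2.length) hq
    have h1 := congrArg Prod.fst hy
    have h2 := congrArg Prod.snd hy
    simp only [Rect.place] at h1 h2
    obtain ⟨w1, hw1⟩ := exists_append_of_stream h1 (by simp; omega)
    obtain ⟨w2, hw2⟩ := exists_append_of_stream h2 (by simp; omega)
    refine ⟨(q'.1 ++ w1, q'.2 ++ w2), fun z => ?_⟩
    rw [Equiv.Perm.mul_apply]
    simp only
    rw [place_append, hr', ← place_append, hw1, hw2, place_append, hq', place_append]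

end Thompson2V

/-- The higher-dimensional Thompson group `2V`. -/
def TwoV : Subgroup (Equiv.Perm Thompson2V.Square) where
  carrier := {f | Thompson2V.IsDyadic f}
  mul_mem' := Thompson2V.IsDyadic.mul
  one_mem' := Thompson2V.isDyadic_one
  inv_mem' := Thompson2V.IsDyadic.inv

namespace Thompson2V

/-! ### Trees with two types of carets -/

/-- The two types of carets: a (triangular) `vert` caret halves a rectangle by a vertical segment,
a (square) `horiz` caret halves it by a horizontal segment. -/
inductive Caret : Type
  | vert
  | horiz

/-- The half of a rectangle position cut out by a caret: prepend one digit in one coordinate. -/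
def Caret.child : Caret → Bool → Rect → Rect
  | .vert, e, r => (e :: r.1, r.2)
  | .horiz, e, r => (r.1, e :: r.2)

/-- The basic dyadic rectangles at the leaves of a tree, from left to right. -/
def leafRects : BinaryTree Caret → List Rect
  | .nil => [([], [])]
  | .node c l r => (leafRects l).map (c.child false) ++ (leafRects r).map (c.child true)

/-- The basic dyadic intervals at the leaves of a tree of a single type, from left to right. -/
def leafIntervals : BinaryTree Unit → List (List Bool)
  | .nil => [[]]
  | .node _ l r => (leafIntervals l).map (List.cons false) ++ (leafIntervals r).map (List.cons true)

/-- The tree obtained from `T` by hanging a copy of `H` from every leaf. -/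
def hang : BinaryTree Caret → BinaryTree Caret → BinaryTree Caret
  | .nil, H => H
  | .node c l r, H => .node c (hang l H) (hang r H)

/-- The tree all of whose carets have type `c`. -/
def paint (c : Caret) (T : BinaryTree Unit) : BinaryTree Caret := T.map fun _ => c

/-- The tree of the grid square given by `Tv` and `Th`: a copy of `Th`, with horizontal carets,
hangs from each leaf of `Tv`, which has vertical carets. -/
def gridTree (Tv Th : BinaryTree Unit) : BinaryTree Caret :=
  hang (paint .vert Tv) (paint .horiz Th)

/-! ### Grid diagrams -/

/-- A grid tree-pair diagram: a source grid square given by its two trees, and a target square with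
a subdivision obtained by repeated halving, whose rectangles are listed in the order of the
rectangles of the source (the leaves of `gridTree Tv Th` from left to right). -/
structure GridDiagram : Type where
  Tv : BinaryTree Unit
  Th : BinaryTree Unit
  target : List Rect
  length_target : target.length = (leafRects (gridTree Tv Th)).length
  isSubdivision : ∃ S : BinaryTree Caret, target.Perm (leafRects S)

/-- The diagram `D` represents `f`: each rectangle of the source grid is mapped affinely onto the
corresponding rectangle of the target. -/
def GridDiagram.Represents (D : GridDiagram) (f : Equiv.Perm Square) : Prop :=
  List.Forall₂ (MapsRect f) (leafRects (gridTree D.Tv D.Th)) D.target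

/-- No exposed caret of `Tv` can be erased: if the leaves of an exposed caret are the two halves of
`I`, then for some leaf `J` of `Th` the map is not affine on `I × J` with a basic dyadic rectangle
as its image. -/
def GridDiagram.VerticallyReduced (D : GridDiagram) (f : Equiv.Perm Square) : Prop :=
  ∀ I : List Bool, I ++ [false] ∈ leafIntervals D.Tv → I ++ [true] ∈ leafIntervals D.Tv →
    ∃ J ∈ leafIntervals D.Th, ¬ ∃ r' : Rect, MapsRect f (I, J) r'

/-- No exposed caret of `Th` can be erased. -/
def GridDiagram.HorizontallyReduced (D : GridDiagram) (f : Equiv.Perm Square) : Prop :=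
  ∀ J : List Bool, J ++ [false] ∈ leafIntervals D.Th → J ++ [true] ∈ leafIntervals D.Th →
    ∃ I ∈ leafIntervals D.Tv, ¬ ∃ r' : Rect, MapsRect f (I, J) r'

/-- `D` is a reduced grid tree-pair diagram of `f`. -/
def GridDiagram.IsReducedFor (D : GridDiagram) (f : Equiv.Perm Square) : Prop :=
  D.Represents f ∧ D.VerticallyReduced f ∧ D.HorizontallyReduced f

/-! ### Elements given by trees -/

/-- Halving the square. -/
def halve : Caret → Square ≃ Bool × Square
  | .vert =>
    { toFun := fun z => (z.1.head, (z.1.tail, z.2))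
      invFun := fun p => (Stream'.cons p.1 p.2.1, p.2.2)
      left_inv := fun z => Prod.ext (Stream'.eta z.1) rfl
      right_inv := fun _ => rfl }
  | .horiz =>
    { toFun := fun z => (z.2.head, (z.1, z.2.tail))
      invFun := fun p => (p.2.1, Stream'.cons p.1 p.2.2)
      left_inv := fun z => Prod.ext rfl (Stream'.eta z.2)
      right_inv := fun _ => rfl }

/-- A point of the square is sent to the number of the leaf rectangle of `T` that contains it
(leaves are numbered `0, 1, 2, …` from left to right) and its relative position there. -/
def locate : (T : BinaryTree Caret) → Square ≃ Fin T.numLeaves × Square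
  | .nil => (Equiv.uniqueProd Square (Fin 1)).symm
  | .node c l r =>
    (halve c).trans <| (Equiv.boolProdEquivSum Square).trans <|
      (Equiv.sumCongr (locate l) (locate r)).trans <|
        (Equiv.sumProdDistrib (Fin l.numLeaves) (Fin r.numLeaves) Square).symm.trans <|
          Equiv.prodCongr finSumFinEquiv (Equiv.refl Square)

/-- The element of the tree-pair diagram with source tree `T`, target tree `S` and bijection `σ` of
the leaves. -/
def ofDiagram (T S : BinaryTree Caret) (σ : Fin T.numLeaves ≃ Fin S.numLeaves) :
    Equiv.Perm Square :=
  (locate T).trans <| (Equiv.prodCongr σ (Equiv.refl Square)).trans (locate S).symm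

/-- The all-right tree with `k` carets, all of them vertical. -/
def allRight : ℕ → BinaryTree Caret
  | 0 => .nil
  | k + 1 => .node .vert .nil (allRight k)

theorem numLeaves_allRight (k : ℕ) : (allRight k).numLeaves = k + 1 := by
  induction k with
  | zero => rfl
  | succ k ih => simp [allRight, ih, Nat.add_comm]

/-- The positive element of the tree `T`: it maps the leaves of `T`, in order, to the leaves of the
all-right tree with as many carets. -/
def ofTree (T : BinaryTree Caret) : Equiv.Perm Square :=
  ofDiagram T (allRight T.numNodes) <|
    finCongr (T.numLeaves_eq_numNodes_succ.trans (numLeaves_allRight T.numNodes).symm)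

/-- The element that permutes the leaves of the all-right tree with `k` carets by `σ`. -/
def ofPerm (k : ℕ) (σ : Equiv.Perm (Fin (k + 1))) : Equiv.Perm Square :=
  ofDiagram (allRight k) (allRight k) <|
    ((finCongr (numLeaves_allRight k)).trans σ).trans (finCongr (numLeaves_allRight k).symm)

/-! ### The infinite generating set and words -/

/-- The letters `Aᵢ, Bᵢ, Cᵢ, Πᵢ, Π̄ᵢ`. -/
inductive Letter : Type
  | A (i : ℕ)
  | B (i : ℕ)
  | C (i : ℕ)
  | P (i : ℕ)
  | Pbar (i : ℕ)

/-- The all-right tree with `i + 1` vertical carets, with `t` hanging from leaf `i`. -/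
def attach : ℕ → BinaryTree Caret → BinaryTree Caret
  | 0, t => .node .vert t .nil
  | i + 1, t => .node .vert .nil (attach i t)

/-- The all-right tree with carets number `0, …, i`, of which only the last one is horizontal. -/
def squareEnd : ℕ → BinaryTree Caret
  | 0 => .node .horiz .nil .nil
  | i + 1 => .node .vert .nil (squareEnd i)

/-- The generators of `2V`. The last two interchange the leaves `i` and `i + 1` of the all-right tree
with `i + 3` leaves, respectively `i + 2` leaves. -/
def Letter.val : Letter → Equiv.Perm Square
  | .A i => ofTree (attach i (.node .vert .nil .nil))
  | .B i => ofTree (attach i (.node .horiz .nil .nil))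
  | .C i => ofTree (squareEnd i)
  | .P i => ofPerm (i + 2) (Equiv.swap ⟨i, by omega⟩ ⟨i + 1, by omega⟩)
  | .Pbar i => ofPerm (i + 1) (Equiv.swap ⟨i, by omega⟩ ⟨i + 1, by omega⟩)

/-- The element given by a word. Maps act on the right, so the leftmost letter is applied first. -/
def eval : List Letter → Equiv.Perm Square
  | [] => Equiv.refl Square
  | x :: w => x.val.trans (eval w)

/-- The word `A₀^{a 0} A₁^{a 1} ⋯ Aₙ^{a n}`. -/
def wordA (n : ℕ) (a : ℕ → ℕ) : List Letter :=
  (List.range (n + 1)).flatMap fun j => List.replicate (a j) (.A j)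

/-- The word `B_k^{b 0} B_{k+1}^{b 1} ⋯ B_{k+m}^{b m}`. -/
def wordB (k m : ℕ) (b : ℕ → ℕ) : List Letter :=
  (List.range (m + 1)).flatMap fun p => List.replicate (b p) (.B (k + p))

/-- The word `C_i C_{i+1} ⋯ C_{i+s-1}` with `s` letters. -/
def wordC (i s : ℕ) : List Letter := (List.range s).map fun t => .C (i + t)

/-- The word `A_k^e B_k^{b 0} B_{k+1}^{b 1} ⋯ B_{k+m}^{b m}`. -/
def block (k e m : ℕ) (b : ℕ → ℕ) : List Letter := List.replicate e (.A k) ++ wordB k m b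

/-- The concatenation of `C_i ⋯ C_{i+s-1}`, the `n` blocks with exponents `a j` and `b'`, and the
final block with exponents `a n` and `b`. -/
def gridWord (n m i s : ℕ) (a b b' : ℕ → ℕ) : List Letter :=
  wordC i s ++ ((List.range n).flatMap fun j => block ((m + 1) * j) (a j) m b') ++
    block ((m + 1) * n) (a n) m b

/-- `w` is a word of the form `gridWord` for trees with `n + 1` and `m + 1` leaves. -/
def IsGridWord (n m : ℕ) (w : List Letter) : Prop :=
  ∃ (i s : ℕ) (a b b' : ℕ → ℕ), w = gridWord n m i s a b b'

/-- `w` is a positive prefix word of `f`: a word of the grid form which is the positive element of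
the source tree of a reduced grid diagram of `f`. -/
def IsPrefixWord (f : Equiv.Perm Square) (w : List Letter) : Prop :=
  ∃ D : GridDiagram, D.IsReducedFor f ∧ IsGridWord D.Tv.numNodes D.Th.numNodes w ∧
    eval w = ofTree (gridTree D.Tv D.Th)

/-- The number of carets on the spine (the right side) of a tree. -/
def spineCarets : BinaryTree Unit → ℕ
  | .nil => 0
  | .node _ _ r => spineCarets r + 1

/-- The exponent of leaf `p` of a tree that hangs off the spine: the length of the maximal path of
left edges that goes up from the leaf. -/
def interiorExponent : BinaryTree Unit → ℕ → ℕ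
  | .nil, _ => 0
  | .node _ l r, p =>
    if p < l.numLeaves then interiorExponent l p + (if p = 0 then 1 else 0)
    else interiorExponent r (p - l.numLeaves)

/-- The exponent of leaf `p` of a tree on the spine: the length of the maximal path of left edges
that goes up from the leaf and does not reach the right side of the tree. -/
def spineExponent : BinaryTree Unit → ℕ → ℕ
  | .nil, _ => 0
  | .node _ l r, p =>
    if p < l.numLeaves then interiorExponent l p else spineExponent r (p - l.numLeaves)

/-- A positive word in standard form: letters `C` with increasing indices, followed by letters
`A` and `B` with nondecreasing indices. -/
def IsStandardPositive (w : List Letter) : Prop :=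
  ∃ (c : List ℕ) (x : List (Bool × ℕ)), c.Pairwise (· < ·) ∧ (x.map Prod.snd).Pairwise (· ≤ ·) ∧
    w = c.map .C ++ x.map fun y => if y.1 then .B y.2 else .A y.2

/-- A word in the letters `Πᵢ, Π̄ᵢ`. -/
def IsPermutationWord (w : List Letter) : Prop :=
  ∀ x ∈ w, ∃ i, x = .P i ∨ x = .Pbar i

end Thompson2V

namespace Thompson2V

/-! A caret off the spine contributes a letter `A` or `B` numbered by the leftmost leaf below it,
and the horizontal spine carets contribute the letters `C`, so every tree has a standard positive
word. The exponent at a leaf counts the carets whose leftmost leaf it is; for grid trees this gives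
the words of the theorem.

These words are determined by their values. The two coordinates are contracted at different rates
near the corner at which both consist of ones, and the difference is the number of letters `C`;
comparing the numbers of leading ones in the first coordinates of two points then gives the index of
the first `C`. After cancelling the letters `C`, leaf `k` of the right spine shows the exponents `a`
and `b` of `A_k` and `B_k`: a corner of this leaf, of relative size `2 ^ (-a) × 2 ^ (-b)`, is mapped
onto the whole leaf.

A grid diagram of `f` is the same as a pair of trees such that `f` is affine on all rectangles of
the grid, because the images of these rectangles tile the square and every finite dyadic tiling
comes from a tree. Every sufficiently fine grid has this property, and one with the least number of
carets is reduced. If a reduced grid had a caret that another grid does not need, then an exposed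
caret of it would lie below a leaf interval of the other grid; `f` is affine on both halves of the
rectangle of this caret, and on a strip through both, which forces `f` to be affine on the whole.
Hence any two reduced grids refine each other. -/

/-! ### Halves of the square and the right spine -/

/-- The point of one half of the square, given by its relative position in that half. -/
def half (c : Caret) (e : Bool) (z : Square) : Square := (halve c).symm (e, z)

theorem exists_eq_half (c : Caret) (z : Square) : ∃ e x, z = half c e x :=
  ⟨(halve c z).1, (halve c z).2, ((halve c).symm_apply_apply z).symm⟩

theorem half_eq_half_iff {c : Caret} {d e : Bool} {x y : Square} :
    half c d x = half c e y ↔ d = e ∧ x = y := by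
  simp [half]

theorem half_injective (c : Caret) (e : Bool) : Function.Injective (half c e) :=
  fun _ _ h => (half_eq_half_iff.1 h).2

theorem half_vert_half_horiz (d e : Bool) (z : Square) :
    half .vert d (half .horiz e z) = half .horiz e (half .vert d z) := rfl

theorem place_child (c : Caret) (e : Bool) (r : Rect) (z : Square) :
    Rect.place (c.child e r) z = half c e (Rect.place r z) := by
  cases c <;> rfl

/-- The point of the last leaf of the all-right tree with `k` carets, given by its relative
position. -/
def spineTail (k : ℕ) : Square → Square := (half .vert true)^[k]

/-- The point of leaf `k` of an all-right tree with more than `k` carets, given by its relative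
position. -/
def spineLeaf (k : ℕ) (z : Square) : Square := spineTail k (half .vert false z)

/-- The point of leaf `p` of the all-right tree with `k` carets, given by its relative position. -/
def allRightLeaf (k p : ℕ) (z : Square) : Square := if p < k then spineLeaf p z else spineTail k z

theorem spineTail_zero (z : Square) : spineTail 0 z = z := rfl

theorem spineTail_one (z : Square) : spineTail 1 z = half .vert true z := rfl

theorem spineTail_add (j k : ℕ) (z : Square) : spineTail (j + k) z = spineTail j (spineTail k z) :=
  Function.iterate_add_apply _ j k z

theorem spineTail_injective (k : ℕ) : Function.Injective (spineTail k) :=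
  (half_injective .vert true).iterate k

theorem spineTail_spineLeaf (j k : ℕ) (z : Square) :
    spineTail j (spineLeaf k z) = spineLeaf (j + k) z :=
  (spineTail_add j k _).symm

theorem spineLeaf_injective (k : ℕ) : Function.Injective (spineLeaf k) :=
  (spineTail_injective k).comp (half_injective .vert false)

theorem le_of_spineLeaf_eq_spineTail {j k : ℕ} {x y : Square} (h : spineLeaf j x = spineTail k y) :
    k ≤ j := by
  by_contra! hjk
  obtain ⟨d, rfl⟩ := Nat.exists_eq_add_of_lt hjk
  rw [Nat.add_assoc, Nat.add_comm d, spineLeaf, spineTail_add, spineTail_add, spineTail_one] at h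
  exact absurd (half_eq_half_iff.1 (spineTail_injective j h)).1 Bool.false_ne_true

theorem allRightLeaf_of_lt {k p : ℕ} (h : p < k) (z : Square) :
    allRightLeaf k p z = spineLeaf p z := if_pos h

theorem allRightLeaf_self (k : ℕ) (z : Square) : allRightLeaf k k z = spineTail k z :=
  if_neg (lt_irrefl k)

theorem spineTail_allRightLeaf (j k p : ℕ) (z : Square) :
    spineTail j (allRightLeaf k p z) = allRightLeaf (j + k) (j + p) z := by
  simp only [allRightLeaf, Nat.add_lt_add_iff_left, apply_ite (spineTail j), spineTail_spineLeaf,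
    spineTail_add]

/-! ### Leaves and their rectangles -/

theorem numNodes_node {α : Type*} (c : α) (l r : BinaryTree α) :
    (BinaryTree.node c l r).numNodes = l.numLeaves + r.numNodes := by
  rw [l.numLeaves_eq_numNodes_succ, BinaryTree.numNodes, Nat.add_right_comm]

theorem locate_half_false (c : Caret) (l r : BinaryTree Caret) (z : Square) :
    locate (.node c l r) (half c false z) =
      (Fin.castAdd r.numLeaves (locate l z).1, (locate l z).2) := by
  cases c <;> rfl

theorem locate_half_true (c : Caret) (l r : BinaryTree Caret) (z : Square) :
    locate (.node c l r) (half c true z) =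
      (Fin.natAdd l.numLeaves (locate r z).1, (locate r z).2) := by
  cases c <;> rfl

theorem locate_symm_castAdd (c : Caret) (l r : BinaryTree Caret) (p : Fin l.numLeaves)
    (z : Square) :
    (locate (.node c l r)).symm (Fin.castAdd r.numLeaves p, z) =
      half c false ((locate l).symm (p, z)) :=
  (Equiv.symm_apply_eq _).2 (by rw [locate_half_false, Equiv.apply_symm_apply]; rfl)

theorem locate_symm_natAdd (c : Caret) (l r : BinaryTree Caret) (p : Fin r.numLeaves)
    (z : Square) :
    (locate (.node c l r)).symm (Fin.natAdd l.numLeaves p, z) =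
      half c true ((locate r).symm (p, z)) :=
  (Equiv.symm_apply_eq _).2 (by rw [locate_half_true, Equiv.apply_symm_apply]; rfl)

theorem length_leafRects (T : BinaryTree Caret) : (leafRects T).length = T.numLeaves := by
  induction T with
  | nil => rfl
  | node c l r ihl ihr => simp [leafRects, ihl, ihr]

theorem locate_symm_apply (T : BinaryTree Caret) (p : Fin T.numLeaves) (z : Square) :
    (locate T).symm (p, z) =
      Rect.place ((leafRects T)[(p : ℕ)]'((length_leafRects T).symm ▸ p.isLt)) z := by
  induction T with
  | nil =>
    obtain rfl := Subsingleton.elim (α := Fin 1) p 0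
    rfl
  | node c l r ihl ihr =>
    induction p using Fin.addCases with
    | left p =>
      have hp : (p : ℕ) < ((leafRects l).map (c.child false)).length := by
        simp [length_leafRects]
      simp only [locate_symm_castAdd, ihl, leafRects, Fin.val_castAdd,
        List.getElem_append_left hp, List.getElem_map, place_child]
    | right p =>
      simp only [locate_symm_natAdd, ihr, leafRects, Fin.val_natAdd, List.getElem_append_right,
        List.length_map, length_leafRects, Nat.le_add_right, Nat.add_sub_cancel_left,
        List.getElem_map, place_child]

theorem locate_symm_allRight (k : ℕ) (p : Fin (allRight k).numLeaves) (z : Square) :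
    (locate (allRight k)).symm (p, z) = allRightLeaf k p z := by
  induction k with
  | zero => rfl
  | succ k ih =>
    induction p using Fin.addCases with
    | left p =>
      obtain rfl := Subsingleton.elim (α := Fin 1) p 0
      rfl
    | right p =>
      refine (locate_symm_natAdd .vert .nil (allRight k) p z).trans ?_
      rw [ih, ← spineTail_one, spineTail_allRightLeaf, Nat.add_comm 1 k]
      rfl

theorem ofTree_apply (T : BinaryTree Caret) (z : Square) :
    ofTree T z = allRightLeaf T.numNodes (locate T z).1 (locate T z).2 :=
  locate_symm_allRight _ _ _

theorem ofTree_nil : ofTree .nil = Equiv.refl Square := Equiv.ext fun z => ofTree_apply .nil z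

theorem ofTree_half_false (c : Caret) (l r : BinaryTree Caret) (z : Square) :
    ofTree (.node c l r) (half c false z) = spineLeaf (locate l z).1 (locate l z).2 := by
  rw [ofTree_apply, locate_half_false, BinaryTree.numNodes]
  have hlt : ((locate l z).1 : ℕ) < l.numNodes + 1 :=
    (locate l z).1.isLt.trans_eq l.numLeaves_eq_numNodes_succ
  exact allRightLeaf_of_lt (hlt.trans_le (by omega)) _

theorem ofTree_half_true (c : Caret) (l r : BinaryTree Caret) (z : Square) :
    ofTree (.node c l r) (half c true z) = spineTail l.numLeaves (ofTree r z) := by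
  rw [ofTree_apply, ofTree_apply, locate_half_true, spineTail_allRightLeaf, numNodes_node]
  rfl

theorem exists_eq_spineLeaf_or_eq_spineTail (k : ℕ) (z : Square) :
    (∃ j < k, ∃ x, z = spineLeaf j x) ∨ ∃ x, z = spineTail k x := by
  induction k generalizing z with
  | zero => exact .inr ⟨z, rfl⟩
  | succ k ih =>
    rcases ih z with ⟨j, hj, x, rfl⟩ | ⟨x, rfl⟩
    · exact .inl ⟨j, hj.trans (Nat.lt_succ_self k), x, rfl⟩
    · obtain ⟨e, y, rfl⟩ := exists_eq_half .vert x
      cases e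
      · exact .inl ⟨k, Nat.lt_succ_self k, y, rfl⟩
      · exact .inr ⟨y, (spineTail_add k 1 y).symm⟩

open Classical in
/-- The copy of `f` on the last leaf of the all-right tree with `k` carets, extended by the identity
to the other leaves. -/
noncomputable def shift (k : ℕ) (f : Equiv.Perm Square) : Equiv.Perm Square :=
  f.extendDomain (Equiv.ofInjective (spineTail k) (spineTail_injective k))

theorem shift_spineTail (k : ℕ) (f : Equiv.Perm Square) (z : Square) :
    shift k f (spineTail k z) = spineTail k (f z) := by
  classical
  exact f.extendDomain_apply_image (Equiv.ofInjective (spineTail k) (spineTail_injective k)) z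

theorem shift_spineLeaf {j k : ℕ} (h : j < k) (f : Equiv.Perm Square) (z : Square) :
    shift k f (spineLeaf j z) = spineLeaf j z := by
  classical
  refine Equiv.Perm.extendDomain_apply_not_subtype f _ ?_
  rintro ⟨y, hy⟩
  exact absurd (le_of_spineLeaf_eq_spineTail hy.symm) (Nat.not_le.2 h)

theorem eq_shift {k : ℕ} {f g : Equiv.Perm Square}
    (hleaf : ∀ j < k, ∀ z, f (spineLeaf j z) = spineLeaf j z)
    (htail : ∀ z, f (spineTail k z) = spineTail k (g z)) : f = shift k g := by
  ext1 z
  rcases exists_eq_spineLeaf_or_eq_spineTail k z with ⟨j, hj, x, rfl⟩ | ⟨x, rfl⟩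
  · rw [hleaf j hj, shift_spineLeaf hj]
  · rw [htail, shift_spineTail]

theorem shift_refl (k : ℕ) : shift k (Equiv.refl Square) = Equiv.refl Square :=
  (eq_shift (fun _ _ _ => rfl) fun _ => rfl).symm

theorem shift_trans (k : ℕ) (f g : Equiv.Perm Square) :
    shift k (f.trans g) = (shift k f).trans (shift k g) := by
  classical exact (Equiv.Perm.extendDomain_trans _ f g).symm

theorem shift_zero (f : Equiv.Perm Square) : shift 0 f = f :=
  (eq_shift (fun _ h => absurd h (Nat.not_lt_zero _)) fun _ => rfl).symm

theorem shift_add (j k : ℕ) (f : Equiv.Perm Square) : shift (j + k) f = shift j (shift k f) := by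
  refine (eq_shift (fun i hi z => ?_) fun z => ?_).symm
  · rcases Nat.lt_or_ge i j with hij | hij
    · exact shift_spineLeaf hij _ z
    · obtain ⟨d, rfl⟩ := Nat.exists_eq_add_of_le hij
      rw [← spineTail_spineLeaf, shift_spineTail, shift_spineLeaf (Nat.add_lt_add_iff_left.1 hi)]
  · rw [spineTail_add, shift_spineTail, shift_spineTail, ← spineTail_add]

/-! ### Positive elements of trees and of letters -/

theorem ofTree_node_nil (T : BinaryTree Caret) :
    ofTree (.node .vert .nil T) = shift 1 (ofTree T) := by
  refine eq_shift (fun j hj z => ?_) fun z => ofTree_half_true .vert .nil T z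
  obtain rfl := Nat.lt_one_iff.1 hj
  exact ofTree_half_false .vert .nil T z

theorem ofTree_attach (k : ℕ) (T : BinaryTree Caret) :
    ofTree (attach k T) = shift k (ofTree (.node .vert T .nil)) := by
  induction k with
  | zero => exact (shift_zero _).symm
  | succ k ih => rw [attach, ofTree_node_nil, ih, ← shift_add, Nat.add_comm]

theorem ofTree_squareEnd (k : ℕ) :
    ofTree (squareEnd k) = shift k (ofTree (.node .horiz .nil .nil)) := by
  induction k with
  | zero => exact (shift_zero _).symm
  | succ k ih => rw [squareEnd, ofTree_node_nil, ih, ← shift_add, Nat.add_comm]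

theorem ofTree_node_vert (l r : BinaryTree Caret) :
    ofTree (.node .vert l r) =
      (ofTree (.node .vert l .nil)).trans (shift l.numLeaves (ofTree r)) := by
  ext1 z
  obtain ⟨e, x, rfl⟩ := exists_eq_half .vert z
  cases e
  · rw [Equiv.trans_apply, ofTree_half_false, ofTree_half_false,
      shift_spineLeaf (locate l x).1.isLt]
  · rw [Equiv.trans_apply, ofTree_half_true, ofTree_half_true, ofTree_nil, Equiv.refl_apply,
      shift_spineTail]

theorem ofTree_node_node (c : Caret) (l r : BinaryTree Caret) :
    ofTree (.node .vert (.node c l r) .nil) =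
      (ofTree (.node .vert (.node c .nil .nil) .nil)).trans
        (ofTree (.node .vert l (.node .vert r .nil))) := by
  ext1 z
  obtain ⟨d, x, rfl⟩ := exists_eq_half .vert z
  cases d
  · obtain ⟨e, y, rfl⟩ := exists_eq_half c x
    rw [Equiv.trans_apply, ofTree_half_false, ofTree_half_false]
    cases e
    · rw [locate_half_false, locate_half_false]
      exact (ofTree_half_false .vert l _ y).symm
    · rw [locate_half_true, locate_half_true]
      refine Eq.trans ?_ (ofTree_half_true .vert l _ (half .vert false y)).symm
      rw [ofTree_half_false, spineTail_spineLeaf]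
      rfl
  · rw [Equiv.trans_apply, ofTree_half_true, ofTree_half_true, ofTree_nil,
      Equiv.refl_apply]
    refine Eq.trans ?_ (ofTree_half_true .vert l _ (half .vert true x)).symm
    rw [ofTree_half_true, ofTree_nil, Equiv.refl_apply, ← spineTail_add]
    rfl

/-- The letter `A k` or `B k`, according to the type of the caret that it adds at leaf `k` off the
spine. -/
def caretLetter : Caret × ℕ → Letter
  | (.vert, k) => .A k
  | (.horiz, k) => .B k

theorem caretLetter_val (c : Caret) (k : ℕ) :
    (caretLetter (c, k)).val = shift k (ofTree (.node .vert (.node c .nil .nil) .nil)) := by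
  cases c <;> exact ofTree_attach k _

theorem C_val (k : ℕ) : (Letter.C k).val = shift k (ofTree (.node .horiz .nil .nil)) :=
  ofTree_squareEnd k

theorem caretLetter_spineLeaf_of_lt (c : Caret) {j k : ℕ} (h : j < k) (z : Square) :
    (caretLetter (c, k)).val (spineLeaf j z) = spineLeaf j z := by
  rw [caretLetter_val, shift_spineLeaf h]

theorem caretLetter_spineLeaf_half_false (c : Caret) (k : ℕ) (z : Square) :
    (caretLetter (c, k)).val (spineLeaf k (half c false z)) = spineLeaf k z := by
  rw [caretLetter_val, spineLeaf, shift_spineTail, ofTree_half_false, locate_half_false,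
    spineTail_spineLeaf]
  rfl

theorem caretLetter_spineLeaf_half_true (c : Caret) (k : ℕ) (z : Square) :
    (caretLetter (c, k)).val (spineLeaf k (half c true z)) = spineLeaf (k + 1) z := by
  rw [caretLetter_val, spineLeaf, shift_spineTail, ofTree_half_false, locate_half_true,
    spineTail_spineLeaf]
  rfl

theorem caretLetter_spineTail_of_lt (c : Caret) {j k : ℕ} (h : k < j) (z : Square) :
    (caretLetter (c, k)).val (spineTail j z) = spineTail (j + 1) z := by
  obtain ⟨d, rfl⟩ := Nat.exists_eq_add_of_lt h
  rw [Nat.add_assoc, Nat.add_comm d, spineTail_add, spineTail_add 1, spineTail_one,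
    caretLetter_val, shift_spineTail, ofTree_half_true, ofTree_nil, Equiv.refl_apply,
    ← spineTail_add, ← spineTail_add]
  congr 1
  simp only [BinaryTree.numLeaves]
  omega

theorem C_spineTail_half_true (k : ℕ) (z : Square) :
    (Letter.C k).val (spineTail k (half .horiz true z)) = spineTail (k + 1) z := by
  rw [C_val, shift_spineTail, ofTree_half_true, ofTree_nil, Equiv.refl_apply, ← spineTail_add]
  rfl

theorem C_spineTail_half_false (k : ℕ) (z : Square) :
    (Letter.C k).val (spineTail k (half .horiz false z)) = spineLeaf k z := by
  rw [C_val, shift_spineTail, ofTree_half_false, spineTail_spineLeaf]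
  rfl

theorem eval_cons_apply (x : Letter) (w : List Letter) (z : Square) :
    eval (x :: w) z = eval w (x.val z) := rfl

theorem eval_append (w w' : List Letter) : eval (w ++ w') = (eval w).trans (eval w') := by
  induction w with
  | nil => rfl
  | cons x w ih => rw [List.cons_append, eval, eval, ih, Equiv.trans_assoc]

theorem eval_append_left_cancel {u w w' : List Letter} (h : eval (u ++ w) = eval (u ++ w')) :
    eval w = eval w' := by
  rw [eval_append, eval_append] at h
  exact Equiv.ext fun z => by simpa using Equiv.congr_fun h ((eval u).symm z)

/-! ### The word of a tree -/

/-- The carets of a tree `T` hanging off the spine whose leftmost leaf has number `k`, in preorder,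
each with the number of its leftmost leaf. -/
def interiorCarets : ℕ → BinaryTree Caret → List (Caret × ℕ)
  | _, .nil => []
  | k, .node c l r => (c, k) :: (interiorCarets k l ++ interiorCarets (k + l.numLeaves) r)

/-- The carets of a tree `T` with leftmost leaf `k` that do not lie on its spine, in preorder, each
with the number of its leftmost leaf. -/
def offSpineCarets : ℕ → BinaryTree Caret → List (Caret × ℕ)
  | _, .nil => []
  | k, .node _ l r => interiorCarets k l ++ offSpineCarets (k + l.numLeaves) r

/-- The positions of the horizontal carets on the spine of a tree, where its root has
position `i`. -/
def horizSpine : ℕ → BinaryTree Caret → List ℕ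
  | _, .nil => []
  | i, .node .vert _ r => horizSpine (i + 1) r
  | i, .node .horiz _ r => i :: horizSpine (i + 1) r

/-- The tree with the spine carets of `T` replaced by vertical ones. -/
def verticalSpine : BinaryTree Caret → BinaryTree Caret
  | .nil => .nil
  | .node _ l r => .node .vert l (verticalSpine r)

/-- The standard positive word of a tree: letters `C` for the horizontal spine carets, followed by a
letter `A` or `B` for every caret off the spine. -/
def treeWord (T : BinaryTree Caret) : List Letter :=
  (horizSpine 0 T).map .C ++ (offSpineCarets 0 T).map caretLetter

theorem eval_interiorCarets (k : ℕ) (T : BinaryTree Caret) :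
    eval ((interiorCarets k T).map caretLetter) = shift k (ofTree (.node .vert T .nil)) := by
  induction T generalizing k with
  | nil =>
    rw [ofTree_node_nil, ofTree_nil, shift_refl, shift_refl]
    rfl
  | node c l r ihl ihr =>
    rw [interiorCarets, List.map_cons, List.map_append, eval, eval_append, ihl, ihr,
      caretLetter_val, ofTree_node_node c l r, ofTree_node_vert l (.node .vert r .nil),
      shift_trans, shift_trans, shift_add]

theorem eval_offSpineCarets (k : ℕ) (T : BinaryTree Caret) :
    eval ((offSpineCarets k T).map caretLetter) = shift k (ofTree (verticalSpine T)) := by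
  induction T generalizing k with
  | nil => exact ((congrArg _ ofTree_nil).trans (shift_refl k)).symm
  | node c l r _ ihr =>
    rw [offSpineCarets, List.map_append, eval_append, eval_interiorCarets, ihr, verticalSpine,
      ofTree_node_vert l (verticalSpine r), shift_trans, shift_add]

theorem eval_horizSpine (k : ℕ) (T : BinaryTree Caret) :
    eval ((horizSpine k T).map .C) = shift k (eval ((horizSpine 0 T).map .C)) := by
  induction T generalizing k with
  | nil => exact (shift_refl k).symm
  | node c l r _ ihr =>
    cases c
    · rw [horizSpine, horizSpine, ihr (k + 1), ihr (0 + 1), ← shift_add, Nat.zero_add]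
    · rw [horizSpine, horizSpine, List.map_cons, List.map_cons, eval, eval, ihr (k + 1),
        ihr (0 + 1), shift_trans, C_val, C_val, shift_zero, ← shift_add, Nat.zero_add]

theorem eval_horizSpine_node_half_false (c : Caret) (l r : BinaryTree Caret) (z : Square) :
    eval ((horizSpine 0 (.node c l r)).map .C) (half c false z) = half .vert false z := by
  cases c
  · rw [horizSpine, eval_horizSpine]
    exact shift_spineLeaf Nat.one_pos _ z
  · rw [horizSpine, List.map_cons, eval_cons_apply, eval_horizSpine]
    exact (congrArg _ (C_spineTail_half_false 0 z)).trans (shift_spineLeaf Nat.one_pos _ z)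

theorem eval_horizSpine_node_half_true (c : Caret) (l r : BinaryTree Caret) (z : Square) :
    eval ((horizSpine 0 (.node c l r)).map .C) (half c true z) =
      half .vert true (eval ((horizSpine 0 r).map .C) z) := by
  cases c
  · rw [horizSpine, eval_horizSpine]
    exact shift_spineTail 1 _ z
  · rw [horizSpine, List.map_cons, eval_cons_apply, eval_horizSpine]
    exact (congrArg _ (C_spineTail_half_true 0 z)).trans (shift_spineTail 1 _ z)

theorem eval_horizSpine_trans_ofTree_verticalSpine (T : BinaryTree Caret) :
    (eval ((horizSpine 0 T).map .C)).trans (ofTree (verticalSpine T)) = ofTree T := by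
  induction T with
  | nil => rfl
  | node c l r _ ihr =>
    ext1 z
    obtain ⟨e, x, rfl⟩ := exists_eq_half c z
    rw [Equiv.trans_apply, verticalSpine]
    cases e
    · rw [eval_horizSpine_node_half_false, ofTree_half_false, ofTree_half_false]
    · rw [eval_horizSpine_node_half_true, ofTree_half_true, ofTree_half_true, ← ihr]
      rfl

theorem eval_treeWord (T : BinaryTree Caret) : eval (treeWord T) = ofTree T := by
  rw [treeWord, eval_append, eval_offSpineCarets, shift_zero,
    eval_horizSpine_trans_ofTree_verticalSpine]

theorem mem_interiorCarets {k : ℕ} {T : BinaryTree Caret} {y : Caret × ℕ}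
    (hy : y ∈ interiorCarets k T) : k ≤ y.2 ∧ y.2 < k + T.numLeaves := by
  induction T generalizing k with
  | nil => cases hy
  | node c l r ihl ihr =>
    have := l.numLeaves_pos
    rw [interiorCarets, List.mem_cons, List.mem_append] at hy
    rw [BinaryTree.numLeaves]
    rcases hy with rfl | hy | hy
    · omega
    · have := ihl hy; omega
    · have := ihr hy; omega

theorem le_of_mem_offSpineCarets {k : ℕ} {T : BinaryTree Caret} {y : Caret × ℕ}
    (hy : y ∈ offSpineCarets k T) : k ≤ y.2 := by
  induction T generalizing k with
  | nil => cases hy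
  | node c l r _ ihr =>
    rw [offSpineCarets, List.mem_append] at hy
    rcases hy with hy | hy
    · exact (mem_interiorCarets hy).1
    · have := ihr hy; omega

theorem le_of_mem_horizSpine {i j : ℕ} {T : BinaryTree Caret} (hj : j ∈ horizSpine i T) :
    i ≤ j := by
  induction T generalizing i with
  | nil => cases hj
  | node c l r _ ihr =>
    cases c
    · have := ihr hj; omega
    · rcases List.mem_cons.1 hj with rfl | hj
      · exact le_rfl
      · have := ihr hj; omega

theorem pairwise_interiorCarets (k : ℕ) (T : BinaryTree Caret) :
    (interiorCarets k T).Pairwise fun x y => x.2 ≤ y.2 := by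
  induction T generalizing k with
  | nil => exact .nil
  | node c l r ihl ihr =>
    refine .cons (fun y hy => ?_) (List.pairwise_append.2 ⟨ihl k, ihr _, fun x hx y hy => ?_⟩)
    · exact (mem_interiorCarets (T := .node c l r) (List.mem_cons_of_mem _ hy)).1
    · exact (mem_interiorCarets hx).2.le.trans (mem_interiorCarets hy).1

theorem pairwise_offSpineCarets (k : ℕ) (T : BinaryTree Caret) :
    (offSpineCarets k T).Pairwise fun x y => x.2 ≤ y.2 := by
  induction T generalizing k with
  | nil => exact .nil
  | node _ l r _ ihr =>
    refine List.pairwise_append.2 ⟨pairwise_interiorCarets k l, ihr _, fun x hx y hy => ?_⟩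
    exact (mem_interiorCarets hx).2.le.trans (le_of_mem_offSpineCarets hy)

theorem pairwise_horizSpine (i : ℕ) (T : BinaryTree Caret) :
    (horizSpine i T).Pairwise (· < ·) := by
  induction T generalizing i with
  | nil => exact .nil
  | node c l r _ ihr =>
    cases c
    · exact ihr (i + 1)
    · exact .cons (fun _ hj => le_of_mem_horizSpine hj) (ihr (i + 1))

theorem isStandardPositive_treeWord (T : BinaryTree Caret) : IsStandardPositive (treeWord T) := by
  refine ⟨horizSpine 0 T, (offSpineCarets 0 T).map fun
    | (.vert, k) => (false, k)
    | (.horiz, k) => (true, k), pairwise_horizSpine 0 T, ?_, ?_⟩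
  · rw [List.map_map, List.pairwise_map]
    refine (pairwise_offSpineCarets 0 T).imp ?_
    rintro ⟨_ | _, j⟩ ⟨_ | _, k⟩ hjk <;> exact hjk
  · rw [treeWord, List.map_map]
    congr 1
    refine List.map_congr_left ?_
    rintro ⟨_ | _, k⟩ - <;> rfl

/-! ### The words of grid trees -/

theorem numNodes_paint (c : Caret) (T : BinaryTree Unit) : (paint c T).numNodes = T.numNodes := by
  induction T with
  | nil => rfl
  | node _ l r ihl ihr => exact congrArg₂ (· + · + 1) ihl ihr

theorem numLeaves_paint (c : Caret) (T : BinaryTree Unit) :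
    (paint c T).numLeaves = T.numLeaves := by
  rw [BinaryTree.numLeaves_eq_numNodes_succ, BinaryTree.numLeaves_eq_numNodes_succ, numNodes_paint]

theorem numLeaves_hang (T H : BinaryTree Caret) :
    (hang T H).numLeaves = H.numLeaves * T.numLeaves := by
  induction T with
  | nil => simp [hang]
  | node c l r ihl ihr => simp [hang, ihl, ihr, Nat.mul_add]

theorem hang_nil (T : BinaryTree Caret) : hang T .nil = T := by
  induction T with
  | nil => rfl
  | node c l r ihl ihr => rw [hang, ihl, ihr]

theorem interiorExponent_node_add (u : Unit) (l r : BinaryTree Unit) (p : ℕ) :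
    interiorExponent (.node u l r) (l.numLeaves + p) = interiorExponent r p := by
  simp [interiorExponent]

theorem spineExponent_node_add (u : Unit) (l r : BinaryTree Unit) (p : ℕ) :
    spineExponent (.node u l r) (l.numLeaves + p) = spineExponent r p := by
  simp [spineExponent]

theorem flatMap_range_add {α : Type*} (n m : ℕ) (g : ℕ → List α) :
    (List.range (n + m)).flatMap g =
      (List.range n).flatMap g ++ (List.range m).flatMap fun j => g (n + j) := by
  rw [List.range_add, List.flatMap_append, List.flatMap_map]

theorem flatMap_range_cons {α : Type*} {n : ℕ} {g h : ℕ → List α} {x : α} (hn : 0 < n)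
    (h_zero : g 0 = x :: h 0) (h_pos : ∀ j < n, 0 < j → g j = h j) :
    (List.range n).flatMap g = x :: (List.range n).flatMap h := by
  obtain ⟨m, rfl⟩ := Nat.exists_eq_add_of_lt hn
  rw [Nat.zero_add, List.range_succ_eq_map, List.flatMap_cons, List.flatMap_cons, h_zero,
    List.cons_append, List.flatMap_map, List.flatMap_map]
  congr 2
  refine List.flatMap_congr fun j hj => h_pos _ ?_ j.succ_pos
  have := List.mem_range.1 hj
  omega

theorem interiorCarets_hang_paint (k : ℕ) (c : Caret) (T : BinaryTree Unit) (H : BinaryTree Caret) :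
    interiorCarets k (hang (paint c T) H) = (List.range T.numLeaves).flatMap fun j =>
      List.replicate (interiorExponent T j) (c, k + H.numLeaves * j) ++
        interiorCarets (k + H.numLeaves * j) H := by
  induction T generalizing k with
  | nil => simp [paint, BinaryTree.map, hang, interiorExponent]
  | node u l r ihl ihr =>
    have hnode : interiorCarets k (hang (paint c (.node u l r)) H) = (c, k) ::
      (interiorCarets k (hang (paint c l) H) ++
        interiorCarets (k + (hang (paint c l) H).numLeaves) (hang (paint c r) H)) := rfl
    rw [hnode, numLeaves_hang, numLeaves_paint, ihl, ihr, BinaryTree.numLeaves, flatMap_range_add,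
      ← List.cons_append]
    congr 1
    · refine (flatMap_range_cons l.numLeaves_pos ?_ fun j hj hpos => ?_).symm
      · simp [interiorExponent, l.numLeaves_pos, List.replicate_succ]
      · simp [interiorExponent, hj, hpos.ne']
    · simp only [interiorExponent_node_add, Nat.mul_add, Nat.add_assoc]

theorem interiorCarets_paint (k : ℕ) (c : Caret) (T : BinaryTree Unit) :
    interiorCarets k (paint c T) = (List.range T.numLeaves).flatMap fun j =>
      List.replicate (interiorExponent T j) (c, k + j) := by
  simpa [hang_nil, interiorCarets] using interiorCarets_hang_paint k c T .nil

theorem offSpineCarets_hang_paint (k : ℕ) (c : Caret) (T : BinaryTree Unit)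
    (H : BinaryTree Caret) :
    offSpineCarets k (hang (paint c T) H) = ((List.range T.numNodes).flatMap fun j =>
      List.replicate (spineExponent T j) (c, k + H.numLeaves * j) ++
        interiorCarets (k + H.numLeaves * j) H) ++
      (List.replicate (spineExponent T T.numNodes) (c, k + H.numLeaves * T.numNodes) ++
        offSpineCarets (k + H.numLeaves * T.numNodes) H) := by
  induction T generalizing k with
  | nil => simp [paint, BinaryTree.map, hang, spineExponent]
  | node u l r _ ihr =>
    have hnode : offSpineCarets k (hang (paint c (.node u l r)) H) =
      interiorCarets k (hang (paint c l) H) ++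
        offSpineCarets (k + (hang (paint c l) H).numLeaves) (hang (paint c r) H) := rfl
    rw [hnode, numLeaves_hang, numLeaves_paint, interiorCarets_hang_paint, ihr, numNodes_node,
      flatMap_range_add, List.append_assoc]
    congr 1
    · refine List.flatMap_congr fun j hj => ?_
      simp [spineExponent, List.mem_range.1 hj]
    · simp only [spineExponent_node_add, Nat.mul_add, Nat.add_assoc]

theorem offSpineCarets_paint (k : ℕ) (c : Caret) (T : BinaryTree Unit) :
    offSpineCarets k (paint c T) = (List.range (T.numNodes + 1)).flatMap fun j =>
      List.replicate (spineExponent T j) (c, k + j) := by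
  simpa [hang_nil, interiorCarets, offSpineCarets, List.range_succ] using
    offSpineCarets_hang_paint k c T .nil

theorem horizSpine_hang_paint_vert (i : ℕ) (T : BinaryTree Unit) (H : BinaryTree Caret) :
    horizSpine i (hang (paint .vert T) H) = horizSpine (i + spineCarets T) H := by
  induction T generalizing i with
  | nil => rfl
  | node _ l r _ ihr =>
    exact (ihr (i + 1)).trans (by rw [spineCarets, Nat.add_assoc, Nat.add_comm 1])

theorem horizSpine_paint_vert (i : ℕ) (T : BinaryTree Unit) :
    horizSpine i (paint .vert T) = [] := by
  simpa only [hang_nil, horizSpine] using horizSpine_hang_paint_vert i T .nil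

theorem map_horizSpine_paint_horiz (i : ℕ) (T : BinaryTree Unit) :
    (horizSpine i (paint .horiz T)).map .C = wordC i (spineCarets T) := by
  induction T generalizing i with
  | nil => rfl
  | node _ l r _ ihr =>
    refine (congrArg (Letter.C i :: ·) (ihr (i + 1))).trans ?_
    simp [wordC, spineCarets, List.range_succ_eq_map, Nat.add_assoc, Nat.add_comm 1]

theorem treeWord_paint_vert (T : BinaryTree Unit) :
    treeWord (paint .vert T) = wordA T.numNodes (spineExponent T) := by
  simp [treeWord, horizSpine_paint_vert, offSpineCarets_paint, wordA, caretLetter, List.map_flatMap]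

theorem eval_wordA_spineExponent (T : BinaryTree Unit) :
    eval (wordA T.numNodes (spineExponent T)) = ofTree (paint .vert T) := by
  rw [← treeWord_paint_vert, eval_treeWord]

theorem map_interiorCarets_paint_horiz (k : ℕ) (T : BinaryTree Unit) :
    (interiorCarets k (paint .horiz T)).map caretLetter =
      wordB k T.numNodes (interiorExponent T) := by
  simp [interiorCarets_paint, wordB, caretLetter, List.map_flatMap, T.numLeaves_eq_numNodes_succ]

theorem map_offSpineCarets_paint_horiz (k : ℕ) (T : BinaryTree Unit) :
    (offSpineCarets k (paint .horiz T)).map caretLetter = wordB k T.numNodes (spineExponent T) := by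
  simp [offSpineCarets_paint, wordB, caretLetter, List.map_flatMap]

theorem treeWord_paint_horiz (T : BinaryTree Unit) :
    treeWord (paint .horiz T) =
      wordC 0 (spineCarets T) ++ wordB 0 T.numNodes (spineExponent T) := by
  rw [treeWord, map_horizSpine_paint_horiz, map_offSpineCarets_paint_horiz]

theorem eval_wordC_append_wordB_spineExponent (T : BinaryTree Unit) :
    eval (wordC 0 (spineCarets T) ++ wordB 0 T.numNodes (spineExponent T)) =
      ofTree (paint .horiz T) := by
  rw [← treeWord_paint_horiz, eval_treeWord]

theorem treeWord_node_paint_horiz (T : BinaryTree Unit) :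
    treeWord (.node .vert (paint .horiz T) .nil) = wordB 0 T.numNodes (interiorExponent T) := by
  rw [treeWord, horizSpine, horizSpine, offSpineCarets, offSpineCarets, List.append_nil,
    map_interiorCarets_paint_horiz]
  rfl

theorem eval_wordB_interiorExponent (T : BinaryTree Unit) :
    eval (wordB 0 T.numNodes (interiorExponent T)) =
      ofTree (.node .vert (paint .horiz T) .nil) := by
  rw [← treeWord_node_paint_horiz, eval_treeWord]

/-- The word `P` of the source grid given by the trees `Tv` and `Th`: the grid word whose exponents
are the leaf exponents of these trees. -/
def sourceWord (Tv Th : BinaryTree Unit) : List Letter :=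
  gridWord Tv.numNodes Th.numNodes (spineCarets Tv) (spineCarets Th) (spineExponent Tv)
    (spineExponent Th) (interiorExponent Th)

theorem treeWord_gridTree (Tv Th : BinaryTree Unit) :
    treeWord (gridTree Tv Th) = sourceWord Tv Th := by
  rw [treeWord, gridTree, horizSpine_hang_paint_vert, Nat.zero_add, map_horizSpine_paint_horiz,
    offSpineCarets_hang_paint]
  simp only [List.map_append, List.map_flatMap, List.map_replicate, map_interiorCarets_paint_horiz,
    map_offSpineCarets_paint_horiz, numLeaves_paint, Th.numLeaves_eq_numNodes_succ, Nat.zero_add,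
    sourceWord, gridWord, block, List.append_assoc, caretLetter]

theorem eval_sourceWord (Tv Th : BinaryTree Unit) :
    eval (sourceWord Tv Th) = ofTree (gridTree Tv Th) := by
  rw [← treeWord_gridTree, eval_treeWord]

theorem interiorExponent_eq_or (T : BinaryTree Unit) (p : ℕ) :
    interiorExponent T p = spineExponent T p ∨ interiorExponent T p = spineExponent T p + 1 := by
  induction T generalizing p with
  | nil => exact .inl rfl
  | node _ l r _ ihr =>
    rw [interiorExponent, spineExponent]
    split_ifs
    exacts [.inr rfl, .inl rfl, ihr _]

/-! ### Uniqueness of words -/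

theorem append_stream_injective :
    Function.Injective fun (u : List Bool) (x : Stream' Bool) => u ++ₛ x := by
  intro u v h
  wlog hl : u.length ≤ v.length generalizing u v
  · exact (this h.symm (Nat.le_of_not_le hl)).symm
  obtain ⟨w, rfl⟩ := exists_append_of_stream (congrFun h (.const false)) hl
  cases w with
  | nil => exact (List.append_nil u).symm
  | cons a w =>
    have happ : u ++ₛ .const (!a) = u ++ₛ (a :: w ++ₛ .const !a) :=
      (congrFun h _).trans (Stream'.append_append_stream _ _ _)
    have hhead := congrArg Stream'.head (Stream'.append_right_injective _ _ _ happ)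
    exact absurd hhead (Bool.not_ne_self a)

theorem place_injective : Function.Injective Rect.place := fun _ _ h =>
  Prod.ext
    (append_stream_injective <| funext fun x => congrArg Prod.fst (congrFun h (x, x)))
    (append_stream_injective <| funext fun x => congrArg Prod.snd (congrFun h (x, x)))

theorem place_replicate (d e : Bool) (p q : ℕ) (z : Square) :
    Rect.place (List.replicate p d, List.replicate q e) z =
      (half .vert d)^[p] ((half .horiz e)^[q] z) := by
  induction p with
  | zero =>
    induction q with
    | zero => rfl
    | succ q ih =>
      rw [Function.iterate_succ_apply']
      exact (place_child .horiz e ([], List.replicate q e) z).trans (congrArg (half .horiz e) ih)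
  | succ p ih =>
    rw [Function.iterate_succ_apply']
    exact (place_child .vert d (List.replicate p d, List.replicate q e) z).trans
      (congrArg (half .vert d) ih)

/-- The list of `α k` vertical carets followed by `β k` horizontal carets at leaf `k`, for `k` from
`k₀` to `k₀ + N - 1`. Its image under `caretLetter` is the word of the `A_k ^ α k * B_k ^ β k`. -/
def sortedCarets (k₀ N : ℕ) (α β : ℕ → ℕ) : List (Caret × ℕ) :=
  (List.range N).flatMap fun j =>
    List.replicate (α (k₀ + j)) (.vert, k₀ + j) ++ List.replicate (β (k₀ + j)) (.horiz, k₀ + j)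

theorem sortedCarets_succ (k N : ℕ) (α β : ℕ → ℕ) : sortedCarets k (N + 1) α β =
    List.replicate (α k) (.vert, k) ++ List.replicate (β k) (.horiz, k) ++
      sortedCarets (k + 1) N α β := by
  simp [sortedCarets, List.range_succ_eq_map, List.flatMap_map, Nat.add_assoc, Nat.add_comm 1]

theorem le_of_mem_sortedCarets {k N : ℕ} {α β : ℕ → ℕ} {y : Caret × ℕ}
    (hy : y ∈ sortedCarets k N α β) : k ≤ y.2 := by
  simp only [sortedCarets, List.mem_flatMap, List.mem_append, List.mem_replicate] at hy
  obtain ⟨j, -, ⟨-, rfl⟩ | ⟨-, rfl⟩⟩ := hy <;> exact Nat.le_add_right k j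

theorem eval_map_caretLetter_spineLeaf {u : List (Caret × ℕ)} {k : ℕ} (hu : ∀ y ∈ u, k < y.2)
    (z : Square) : eval (u.map caretLetter) (spineLeaf k z) = spineLeaf k z := by
  induction u with
  | nil => rfl
  | cons y u ih =>
    rw [List.map_cons, eval_cons_apply, caretLetter_spineLeaf_of_lt _ (hu y List.mem_cons_self)]
    exact ih fun x hx => hu x (List.mem_cons_of_mem y hx)

theorem eval_replicate_caretLetter (c : Caret) (e k : ℕ) (z : Square) :
    eval (List.replicate e (caretLetter (c, k))) (spineLeaf k ((half c false)^[e] z)) =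
      spineLeaf k z := by
  induction e with
  | zero => rfl
  | succ e ih =>
    rw [List.replicate_succ, eval_cons_apply, Function.iterate_succ_apply',
      caretLetter_spineLeaf_half_false, ih]

theorem eval_sortedCarets_spineLeaf (k N : ℕ) (α β : ℕ → ℕ) (z : Square) :
    eval ((sortedCarets k (N + 1) α β).map caretLetter)
      (spineLeaf k (Rect.place (List.replicate (α k) false, List.replicate (β k) false) z)) =
      spineLeaf k z := by
  rw [sortedCarets_succ, List.map_append, List.map_append, List.map_replicate, List.map_replicate,
    eval_append, eval_append, Equiv.trans_apply, Equiv.trans_apply, place_replicate,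
    eval_replicate_caretLetter, eval_replicate_caretLetter]
  exact eval_map_caretLetter_spineLeaf (fun _ => le_of_mem_sortedCarets) z

theorem exponents_eq_of_eval_sortedCarets_eq {k N : ℕ} {α β α' β' : ℕ → ℕ}
    (h : eval ((sortedCarets k N α β).map caretLetter) =
      eval ((sortedCarets k N α' β').map caretLetter)) :
    ∀ j < N, α (k + j) = α' (k + j) ∧ β (k + j) = β' (k + j) := by
  induction N generalizing k with
  | zero => exact fun j hj => absurd hj (Nat.not_lt_zero j)
  | succ N ih =>
    have hplace : (List.replicate (α k) false, List.replicate (β k) false) =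
        (List.replicate (α' k) false, List.replicate (β' k) false) :=
      place_injective <| funext fun z => spineLeaf_injective k <| Equiv.injective _ <|
        (eval_sortedCarets_spineLeaf k N α β z).trans <| by
          rw [h, eval_sortedCarets_spineLeaf]
    have hk : α k = α' k ∧ β k = β' k := by
      simpa only [Prod.mk.injEq, List.length_replicate] using
        And.intro (congrArg (List.length ·.1) hplace) (congrArg (List.length ·.2) hplace)
    rintro (_ | j) hj
    · exact hk
    · rw [sortedCarets_succ, sortedCarets_succ, hk.1, hk.2,
        List.map_append (l₂ := sortedCarets (k + 1) N α β),
        List.map_append (l₂ := sortedCarets (k + 1) N α' β')] at h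
      have := ih (eval_append_left_cancel h) j (Nat.lt_of_succ_lt_succ hj)
      rwa [Nat.add_assoc, Nat.add_comm 1] at this

theorem wordA_eq_map_sortedCarets (n : ℕ) (a : ℕ → ℕ) :
    wordA n a = (sortedCarets 0 (n + 1) a 0).map caretLetter := by
  simp [wordA, sortedCarets, List.map_flatMap, caretLetter]

theorem wordB_zero_eq_map_sortedCarets (m : ℕ) (b : ℕ → ℕ) :
    wordB 0 m b = (sortedCarets 0 (m + 1) 0 b).map caretLetter := by
  simp [wordB, sortedCarets, List.map_flatMap, caretLetter]

theorem exponents_eq_of_eval_wordA_eq {n : ℕ} {a a' : ℕ → ℕ}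
    (h : eval (wordA n a) = eval (wordA n a')) : ∀ j ≤ n, a j = a' j := fun j hj => by
  rw [wordA_eq_map_sortedCarets, wordA_eq_map_sortedCarets] at h
  simpa only [Nat.zero_add] using
    (exponents_eq_of_eval_sortedCarets_eq h j (Nat.lt_succ_of_le hj)).1

theorem exponents_eq_of_eval_wordB_eq {m : ℕ} {b b' : ℕ → ℕ}
    (h : eval (wordB 0 m b) = eval (wordB 0 m b')) : ∀ p ≤ m, b p = b' p := fun p hp => by
  rw [wordB_zero_eq_map_sortedCarets, wordB_zero_eq_map_sortedCarets] at h
  simpa only [Nat.zero_add] using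
    (exponents_eq_of_eval_sortedCarets_eq h p (Nat.lt_succ_of_le hp)).2

theorem flatMap_range_mul {α : Type*} (m n : ℕ) (g : ℕ → List α) :
    (List.range (m * n)).flatMap g =
      (List.range n).flatMap fun j => (List.range m).flatMap fun p => g (m * j + p) := by
  induction n with
  | zero => simp
  | succ n ih => simp [Nat.mul_succ, flatMap_range_add, ih, List.range_succ]

theorem block_eq_flatMap (k e m : ℕ) (b : ℕ → ℕ) : block k e m b =
    (List.range (m + 1)).flatMap fun p =>
      List.replicate (if p = 0 then e else 0) (.A (k + p)) ++
        List.replicate (b p) (.B (k + p)) := by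
  simp [block, wordB, List.range_succ_eq_map, List.flatMap_map]

theorem gridWord_eq_wordC_append (n m i s : ℕ) (a b b' : ℕ → ℕ) :
    ∃ α β, gridWord n m i s a b b' =
      wordC i s ++ (sortedCarets 0 ((m + 1) * (n + 1)) α β).map caretLetter := by
  refine ⟨fun k => if k % (m + 1) = 0 then a (k / (m + 1)) else 0,
    fun k => if k / (m + 1) < n then b' (k % (m + 1)) else b (k % (m + 1)), ?_⟩
  have hmod (j p : ℕ) (hp : p < m + 1) : ((m + 1) * j + p) % (m + 1) = p := by
    rw [Nat.mul_add_mod, Nat.mod_eq_of_lt hp]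
  have hdiv (j p : ℕ) (hp : p < m + 1) : ((m + 1) * j + p) / (m + 1) = j := by
    rw [Nat.mul_add_div m.succ_pos, Nat.div_eq_of_lt hp, Nat.add_zero]
  rw [gridWord, sortedCarets, flatMap_range_mul, List.append_assoc, flatMap_range_add,
    List.map_append]
  simp only [block_eq_flatMap, List.map_flatMap, List.map_append, List.map_replicate,
    List.range_one, List.flatMap_singleton, Nat.zero_add, Nat.add_zero, caretLetter]
  congr 2
  · refine List.flatMap_congr fun j hj => List.flatMap_congr fun p hp => ?_
    rw [hmod j p (List.mem_range.1 hp), hdiv j p (List.mem_range.1 hp),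
      if_pos (List.mem_range.1 hj)]
  · refine List.flatMap_congr fun p hp => ?_
    rw [hmod n p (List.mem_range.1 hp), hdiv n p (List.mem_range.1 hp), if_neg (lt_irrefl n)]

theorem wordC_succ (i s : ℕ) : wordC i (s + 1) = .C i :: wordC (i + 1) s := by
  simp [wordC, List.range_succ_eq_map, Nat.add_assoc, Nat.add_comm 1]

theorem eval_wordC (i s : ℕ) : eval (wordC i s) = shift i (eval (wordC 0 s)) := by
  induction s generalizing i with
  | zero => exact (shift_refl i).symm
  | succ s ih =>
    rw [wordC_succ, wordC_succ, eval, eval, ih (i + 1), ih (0 + 1), shift_trans, C_val, C_val,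
      shift_zero, ← shift_add, Nat.zero_add]

theorem spineTail_half_horiz (k : ℕ) (e : Bool) (z : Square) :
    spineTail k (half .horiz e z) = half .horiz e (spineTail k z) :=
  Function.Commute.iterate_left (fun z => half_vert_half_horiz true e z) k z

theorem snd_spineTail (k : ℕ) (z : Square) : (spineTail k z).2 = z.2 := by
  induction k with
  | zero => rfl
  | succ k ih => rw [Nat.add_comm, spineTail_add]; exact ih

theorem eval_wordC_zero_corner (d s : ℕ) (z : Square) :
    eval (wordC 0 s) (spineTail d ((half .horiz true)^[s] z)) = spineTail (d + s) z := by
  induction s with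
  | zero => rfl
  | succ s ih =>
    have hC := C_spineTail_half_true 0 (spineTail d ((half .horiz true)^[s] z))
    rw [spineTail_zero] at hC
    rw [wordC_succ, eval_cons_apply, Function.iterate_succ_apply', spineTail_half_horiz, hC,
      eval_wordC, shift_spineTail, ih, ← spineTail_add]
    congr 1
    omega

theorem eval_wordC_corner {i K : ℕ} (h : i ≤ K) (s : ℕ) (z : Square) :
    eval (wordC i s) (spineTail K ((half .horiz true)^[s] z)) = spineTail (K + s) z := by
  obtain ⟨d, rfl⟩ := Nat.exists_eq_add_of_le h
  rw [eval_wordC, spineTail_add, shift_spineTail, eval_wordC_zero_corner, ← spineTail_add,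
    Nat.add_assoc]

open Filter in
theorem eventually_eval_map_caretLetter_spineTail (u : List (Caret × ℕ)) :
    ∀ᶠ K in atTop, ∀ z,
      eval (u.map caretLetter) (spineTail K z) = spineTail (K + u.length) z := by
  induction u with
  | nil => exact .of_forall fun _ _ => rfl
  | cons y u ih =>
    filter_upwards [eventually_gt_atTop y.2, (tendsto_add_atTop_nat 1).eventually ih]
      with K hyK hK z
    rw [List.map_cons, eval_cons_apply, caretLetter_spineTail_of_lt _ hyK, hK, List.length_cons,
      Nat.add_assoc, Nat.add_comm 1]

theorem length_wordC_eq_of_eval_eq {i i' s s' : ℕ} {u u' : List (Caret × ℕ)}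
    (h : eval (wordC i s ++ u.map caretLetter) = eval (wordC i' s' ++ u'.map caretLetter)) :
    s = s' := by
  wlog hs : s ≤ s' generalizing i i' s s' u u'
  · exact (this h.symm (Nat.le_of_not_le hs)).symm
  obtain ⟨d, rfl⟩ := Nat.exists_eq_add_of_le hs
  obtain ⟨K, hi, hi', hu, hu'⟩ := ((Filter.eventually_ge_atTop i).and <|
    (Filter.eventually_ge_atTop i').and <|
      ((Filter.tendsto_add_atTop_nat s).eventually
        (eventually_eval_map_caretLetter_spineTail u)).and <|
      (Filter.tendsto_add_atTop_nat (s + d)).eventually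
        (eventually_eval_map_caretLetter_spineTail u')).exists
  have hsnd (z : Square) : ((half .horiz true)^[d] z).2 = z.2 := by
    have hz := Equiv.congr_fun h (spineTail K ((half .horiz true)^[s + d] z))
    rw [eval_append, eval_append, Equiv.trans_apply, Equiv.trans_apply, eval_wordC_corner hi', hu',
      Function.iterate_add_apply, eval_wordC_corner hi, hu] at hz
    simpa only [snd_spineTail] using congrArg Prod.snd hz
  have hd : List.replicate d true = [] := append_stream_injective <| funext fun x =>
    ((congrArg Prod.snd (place_replicate true true 0 d (x, x))).trans (hsnd (x, x))).trans
      (Stream'.nil_append_stream x).symm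
  rw [(List.replicate_eq_nil_iff true).1 hd, Nat.add_zero]

/-- The order of the points of the square by the number of leading ones in their first
coordinates. -/
def SpineLT (z z' : Square) : Prop := ∃ j x x', z = spineLeaf j x ∧ z' = spineTail (j + 1) x'

theorem SpineLT.not_symm {z z' : Square} (h : SpineLT z z') : ¬ SpineLT z' z := by
  rintro ⟨k, y, y', hz', hz⟩
  obtain ⟨j, x, x', rfl, rfl⟩ := h
  have := le_of_spineLeaf_eq_spineTail hz
  have := le_of_spineLeaf_eq_spineTail hz'.symm
  omega

theorem SpineLT.apply_caretLetter {z z' : Square} (h : SpineLT z z') (c : Caret) (k : ℕ) :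
    SpineLT ((caretLetter (c, k)).val z) ((caretLetter (c, k)).val z') := by
  obtain ⟨j, x, x', rfl, rfl⟩ := h
  rcases lt_trichotomy j k with hjk | rfl | hkj
  · refine ⟨j, x, shift (k - (j + 1)) (ofTree (.node .vert (.node c .nil .nil) .nil)) x',
      caretLetter_spineLeaf_of_lt c hjk x, ?_⟩
    rw [caretLetter_val, ← shift_spineTail, ← shift_add, Nat.add_sub_cancel' hjk]
  · rw [caretLetter_spineTail_of_lt c (Nat.lt_succ_self j)]
    obtain ⟨e, y, rfl⟩ := exists_eq_half c x
    cases e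
    · exact ⟨j, y, spineTail 1 x', caretLetter_spineLeaf_half_false c j y,
        spineTail_add (j + 1) 1 x'⟩
    · exact ⟨j + 1, y, x', caretLetter_spineLeaf_half_true c j y, rfl⟩
  · exact ⟨j + 1, x, x', caretLetter_spineTail_of_lt c hkj _,
      caretLetter_spineTail_of_lt c (hkj.trans (Nat.lt_succ_self j)) x'⟩

theorem SpineLT.apply_eval {z z' : Square} (h : SpineLT z z') (u : List (Caret × ℕ)) :
    SpineLT (eval (u.map caretLetter) z) (eval (u.map caretLetter) z') := by
  induction u generalizing z z' with
  | nil => exact h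
  | cons y _ ih => exact ih (h.apply_caretLetter y.1 y.2)

theorem spineLT_eval_wordC_of_lt {i i' : ℕ} (h : i < i') (s : ℕ) (x y : Square) :
    SpineLT (eval (wordC i' s) (spineLeaf i x)) (eval (wordC i' s) (spineTail (i + 1) y)) := by
  obtain ⟨d, rfl⟩ := Nat.exists_eq_add_of_le (Nat.succ_le_of_lt h)
  rw [eval_wordC, shift_spineLeaf h, shift_add, shift_spineTail]
  exact ⟨i, x, _, rfl, rfl⟩

theorem spineLT_eval_wordC_succ (i s : ℕ) (x y : Square) :
    SpineLT (eval (wordC i (s + 1)) (spineTail i (half .horiz false x)))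
      (eval (wordC i (s + 1)) (spineTail i (half .horiz true y))) := by
  rw [wordC_succ, eval_cons_apply, eval_cons_apply, C_spineTail_half_false, C_spineTail_half_true]
  exact spineLT_eval_wordC_of_lt (Nat.lt_succ_self i) s x y

/- The letter `C i` moves a point with more than `i` leading ones to leaf `i`, and a point with `i`
leading ones beyond it, while the other letters with larger indices keep their order. -/
theorem le_of_eval_wordC_append_eq {i i' s s' : ℕ} {u u' : List (Caret × ℕ)}
    (h : eval (wordC i (s + 1) ++ u.map caretLetter) = eval (wordC i' s' ++ u'.map caretLetter)) :
    i' ≤ i := by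
  by_contra! hii'
  let x : Square := (.const false, .const false)
  have hlt := (spineLT_eval_wordC_of_lt hii' s' (half .horiz true x)
    (half .horiz false x)).apply_eval u'
  have hgt := (spineLT_eval_wordC_succ i s (half .vert true x)
    (half .vert false x)).apply_eval u
  rw [← Equiv.trans_apply, ← Equiv.trans_apply, ← eval_append] at hlt hgt
  rw [← h, spineTail_add i 1] at hlt
  exact hgt.not_symm hlt

theorem wordC_eq_of_eval_append_eq {i i' s s' : ℕ} {u u' : List (Caret × ℕ)}
    (h : eval (wordC i s ++ u.map caretLetter) = eval (wordC i' s' ++ u'.map caretLetter)) :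
    wordC i s = wordC i' s' := by
  obtain rfl := length_wordC_eq_of_eval_eq h
  cases s with
  | zero => rfl
  | succ s =>
    rw [Nat.le_antisymm (le_of_eval_wordC_append_eq h.symm) (le_of_eval_wordC_append_eq h)]

theorem eq_of_eval_eq_of_isGridWord {n m : ℕ} {w w' : List Letter} (hw : IsGridWord n m w)
    (hw' : IsGridWord n m w') (h : eval w = eval w') : w = w' := by
  obtain ⟨i, s, a, b, c, rfl⟩ := hw
  obtain ⟨i', s', a', b', c', rfl⟩ := hw'
  obtain ⟨α, β, hα⟩ := gridWord_eq_wordC_append n m i s a b c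
  obtain ⟨α', β', hα'⟩ := gridWord_eq_wordC_append n m i' s' a' b' c'
  rw [hα, hα'] at h ⊢
  have hC := wordC_eq_of_eval_append_eq h
  rw [hC] at h
  have hexp := exponents_eq_of_eval_sortedCarets_eq (eval_append_left_cancel h)
  have hlist : sortedCarets 0 ((m + 1) * (n + 1)) α β =
      sortedCarets 0 ((m + 1) * (n + 1)) α' β' := List.flatMap_congr fun j hj => by
    rw [(hexp j (List.mem_range.1 hj)).1, (hexp j (List.mem_range.1 hj)).2]
  rw [hC, hlist]

/-! ### Dyadic tilings are given by trees -/

open Classical in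
/-- The rectangles of `L` tile the square: every point lies in exactly one entry of the list. -/
def IsTiling (L : List Rect) : Prop :=
  ∀ z : Square, (L.countP fun r => z ∈ Set.range (Rect.place r)) = 1

theorem half_mem_range_place_child_iff {c : Caret} {d e : Bool} {r : Rect} {z : Square} :
    half c d z ∈ Set.range (Rect.place (c.child e r)) ↔ d = e ∧ z ∈ Set.range (Rect.place r) := by
  simp only [Set.mem_range, place_child, half_eq_half_iff, eq_comm (a := d), exists_and_left]

theorem IsTiling.perm {L L' : List Rect} (hL : IsTiling L) (h : L.Perm L') : IsTiling L' :=
  fun z => (h.symm.countP_eq _).trans (hL z)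

open Classical in
theorem countP_half_mem_range_children (c : Caret) (L₀ L₁ : List Rect) (e : Bool) (z : Square) :
    ((L₀.map (c.child false) ++ L₁.map (c.child true)).countP
      fun r => half c e z ∈ Set.range (Rect.place r)) =
      (bif e then L₁ else L₀).countP fun r => z ∈ Set.range (Rect.place r) := by
  cases e <;>
    simp only [List.countP_append, List.countP_map, Function.comp_def,
      half_mem_range_place_child_iff, reduceCtorEq, false_and, true_and, decide_false,
      List.countP_false, Function.const_apply, Nat.add_zero, Nat.zero_add, cond_true, cond_false]

theorem isTiling_children_iff {c : Caret} {L₀ L₁ : List Rect} :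
    IsTiling (L₀.map (c.child false) ++ L₁.map (c.child true)) ↔ IsTiling L₀ ∧ IsTiling L₁ := by
  constructor
  · exact fun h => ⟨fun z => (countP_half_mem_range_children c L₀ L₁ false z).symm.trans (h _),
      fun z => (countP_half_mem_range_children c L₀ L₁ true z).symm.trans (h _)⟩
  · rintro ⟨h₀, h₁⟩ z
    obtain ⟨e, x, rfl⟩ := exists_eq_half c z
    rw [countP_half_mem_range_children]
    cases e
    exacts [h₀ x, h₁ x]

theorem isTiling_singleton_root : IsTiling [([], [])] := by
  classical
  exact fun z => List.countP_singleton.trans (if_pos (decide_eq_true ⟨z, rfl⟩))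

theorem isTiling_leafRects (T : BinaryTree Caret) : IsTiling (leafRects T) := by
  induction T with
  | nil => exact isTiling_singleton_root
  | node c l r ihl ihr => exact isTiling_children_iff.2 ⟨ihl, ihr⟩

theorem IsTiling.eq_of_mem_range {L : List Rect} (hL : IsTiling L) {r r' : Rect} (hr : r ∈ L)
    (hr' : r' ∈ L) {z : Square} (hz : z ∈ Set.range (Rect.place r))
    (hz' : z ∈ Set.range (Rect.place r')) : r = r' := by
  classical
  have hcount := hL z
  rw [List.countP_eq_length_filter] at hcount
  obtain ⟨q, hq⟩ := List.length_eq_one_iff.1 hcount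
  have heq (p : Rect) (hp : p ∈ L) (hzp : z ∈ Set.range (Rect.place p)) : p = q :=
    List.mem_singleton.1 (hq ▸ List.mem_filter.2 ⟨hp, decide_eq_true hzp⟩)
  exact (heq r hr hz).trans (heq r' hr' hz').symm

theorem IsTiling.ne_nil {L : List Rect} (hL : IsTiling L) : L ≠ [] := by
  rintro rfl
  exact Nat.zero_ne_one (hL (.const false, .const false))

theorem IsTiling.eq_singleton_root {L : List Rect} (hL : IsTiling L) (h : ([], []) ∈ L) :
    L = [([], [])] := by
  classical
  let z : Square := (.const false, .const false)
  have hall : ∀ r ∈ L, r = ([], []) := fun r hr =>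
    hL.eq_of_mem_range hr h (Set.mem_range_self z) ⟨r.place z, rfl⟩
  have hcount := hL z
  rw [List.countP_eq_length.2 fun r hr => decide_eq_true (hall r hr ▸ ⟨z, rfl⟩)] at hcount
  rw [List.eq_replicate_of_mem hall, hcount, List.replicate_one]

/- A tile of full width and a tile of full height meet, so if both exist they are equal. -/
theorem IsTiling.exists_common_caret {L : List Rect} (hL : IsTiling L) (h : ([], []) ∉ L) :
    ∃ c : Caret, ∀ r ∈ L, ∃ e q, r = c.child e q := by
  by_contra! hno
  obtain ⟨⟨u, v⟩, hr, hwide⟩ := hno .vert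
  obtain ⟨⟨u', v'⟩, hr', hhigh⟩ := hno .horiz
  obtain rfl : u = [] := by
    cases u with
    | nil => rfl
    | cons e u => exact absurd rfl (hwide e (u, v))
  obtain rfl : v' = [] := by
    cases v' with
    | nil => rfl
    | cons e v' => exact absurd rfl (hhigh e (u', v'))
  let x : Stream' Bool := .const false
  have heq := hL.eq_of_mem_range hr hr' (z := (u' ++ₛ x, v ++ₛ x)) ⟨(u' ++ₛ x, x), rfl⟩
    ⟨(x, v ++ₛ x), rfl⟩
  rw [(Prod.mk.inj heq).2] at hr
  exact h hr

theorem exists_perm_children {c : Caret} {L : List Rect} (h : ∀ r ∈ L, ∃ e q, r = c.child e q) :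
    ∃ L₀ L₁ : List Rect, L.Perm (L₀.map (c.child false) ++ L₁.map (c.child true)) := by
  induction L with
  | nil => exact ⟨[], [], .refl _⟩
  | cons r L ih =>
    obtain ⟨L₀, L₁, hL⟩ := ih fun q hq => h q (List.mem_cons_of_mem r hq)
    obtain ⟨e, q, rfl⟩ := h r List.mem_cons_self
    cases e
    · exact ⟨q :: L₀, L₁, hL.cons _⟩
    · exact ⟨L₀, q :: L₁, (hL.cons _).trans List.perm_middle.symm⟩

/-- The number of halvings that lead from the square to the rectangle. -/
def depth (r : Rect) : ℕ := r.1.length + r.2.length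

theorem depth_child (c : Caret) (e : Bool) (r : Rect) : depth (c.child e r) = depth r + 1 := by
  cases c <;> simp only [depth, Caret.child, List.length_cons] <;> omega

theorem sum_depth_map_child (c : Caret) (e : Bool) (L : List Rect) :
    ((L.map (c.child e)).map depth).sum = (L.map depth).sum + L.length := by
  simp [Function.comp_def, depth_child, List.sum_map_add]

theorem IsTiling.exists_tree {L : List Rect} (hL : IsTiling L) :
    ∃ S : BinaryTree Caret, L.Perm (leafRects S) := by
  induction hd : (L.map depth).sum using Nat.strong_induction_on generalizing L with
  | _ d ih =>
    subst hd
    by_cases hroot : ([], []) ∈ L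
    · exact ⟨.nil, .of_eq (hL.eq_singleton_root hroot)⟩
    obtain ⟨c, hc⟩ := hL.exists_common_caret hroot
    obtain ⟨L₀, L₁, hp⟩ := exists_perm_children hc
    obtain ⟨h₀, h₁⟩ := isTiling_children_iff.1 (hL.perm hp)
    have hsum := (hp.map depth).sum_eq
    rw [List.map_append, List.sum_append, sum_depth_map_child, sum_depth_map_child] at hsum
    have hpos₀ := List.length_pos_of_ne_nil h₀.ne_nil
    have hpos₁ := List.length_pos_of_ne_nil h₁.ne_nil
    obtain ⟨S₀, hS₀⟩ := ih (L₀.map depth).sum (by omega) h₀ rfl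
    obtain ⟨S₁, hS₁⟩ := ih (L₁.map depth).sum (by omega) h₁ rfl
    exact ⟨.node c S₀ S₁, hp.trans ((hS₀.map _).append (hS₁.map _))⟩

theorem MapsRect.mem_range_iff {f : Equiv.Perm Square} {r r' : Rect} (h : MapsRect f r r')
    (z : Square) : f z ∈ Set.range (Rect.place r') ↔ z ∈ Set.range (Rect.place r) := by
  constructor
  · rintro ⟨y, hy⟩
    exact ⟨y, f.injective ((h y).trans hy)⟩
  · rintro ⟨y, rfl⟩
    exact ⟨y, (h y).symm⟩

theorem IsTiling.image {f : Equiv.Perm Square} {L L' : List Rect} (hL : IsTiling L)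
    (h : List.Forall₂ (MapsRect f) L L') : IsTiling L' := by
  classical
  have hcount (z : Square) : (L'.countP fun r => f z ∈ Set.range (Rect.place r)) =
      L.countP fun r => z ∈ Set.range (Rect.place r) := by
    clear hL
    induction h with
    | nil => rfl
    | cons hr _ ih => simp only [List.countP_cons, hr.mem_range_iff, ih]
  intro z
  obtain ⟨y, rfl⟩ := f.surjective z
  exact (hcount y).trans (hL y)

/-! ### Grids on which a map is affine -/

theorem MapsRect.unique {f : Equiv.Perm Square} {r r₁ r₂ : Rect} (h₁ : MapsRect f r r₁)
    (h₂ : MapsRect f r r₂) : r₁ = r₂ :=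
  place_injective (funext fun z => (h₁ z).symm.trans (h₂ z))

theorem MapsRect.append {f : Equiv.Perm Square} {r r' : Rect} (h : MapsRect f r r')
    (u v : List Bool) : MapsRect f (r.1 ++ u, r.2 ++ v) (r'.1 ++ u, r'.2 ++ v) := fun z => by
  rw [place_append, place_append, h]

/-- `f` maps the basic dyadic rectangle `r` affinely onto some basic dyadic rectangle. -/
def IsAffineOn (f : Equiv.Perm Square) (r : Rect) : Prop := ∃ r' : Rect, MapsRect f r r'

theorem IsAffineOn.append {f : Equiv.Perm Square} {I J : List Bool} (h : IsAffineOn f (I, J))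
    (u v : List Bool) : IsAffineOn f (I ++ u, J ++ v) := by
  obtain ⟨_, hr⟩ := h
  exact ⟨_, hr.append u v⟩

theorem place_half_vert (I J : List Bool) (e : Bool) (z : Square) :
    Rect.place (I, J) (half .vert e z) = Rect.place (I ++ [e], J) z := by
  have happend := place_append (I, J) [e] [] z
  rw [List.append_nil] at happend
  exact happend.symm

/- The images of the two halves share their vertical extent because a horizontal strip through both
of them has a rectangle as its image. -/
theorem isAffineOn_of_vertical_halves {f : Equiv.Perm Square} {I J v : List Bool}
    (h : ∀ e, IsAffineOn f (I ++ [e], J)) (hv : IsAffineOn f (I, J ++ v)) :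
    IsAffineOn f (I, J) := by
  obtain ⟨⟨P, Q⟩, hstrip⟩ := hv
  have himage (e : Bool) : ∃ S, MapsRect f (I ++ [e], J) (P ++ [e], S) ∧ S ++ v = Q := by
    obtain ⟨⟨R, S⟩, hr⟩ := h e
    have hcorner := hr.append [] v
    have hcorner' := hstrip.append [e] []
    simp only [List.append_nil] at hcorner hcorner'
    obtain ⟨rfl, hS⟩ := Prod.mk.inj (hcorner.unique hcorner')
    exact ⟨S, hr, hS⟩
  obtain ⟨S, hfalse, hS⟩ := himage false
  obtain ⟨S', htrue, hS'⟩ := himage true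
  obtain rfl : S = S' := List.append_cancel_right (hS.trans hS'.symm)
  refine ⟨(P, S), fun z => ?_⟩
  obtain ⟨e, x, rfl⟩ := exists_eq_half .vert z
  rw [place_half_vert, place_half_vert]
  cases e
  exacts [hfalse x, htrue x]

/-- The conjugate of `f` by the reflection that exchanges the two coordinates of the square. -/
def transpose (f : Equiv.Perm Square) : Equiv.Perm Square :=
  Equiv.permCongr (Equiv.prodComm _ _) f

theorem IsAffineOn.transpose {f : Equiv.Perm Square} {I J : List Bool} (h : IsAffineOn f (I, J)) :
    IsAffineOn (transpose f) (J, I) := by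
  obtain ⟨r', hr⟩ := h
  exact ⟨r'.swap, fun z => congrArg Prod.swap (hr z.swap)⟩

theorem isAffineOn_transpose {f : Equiv.Perm Square} {I J : List Bool} :
    IsAffineOn (transpose f) (J, I) ↔ IsAffineOn f (I, J) :=
  ⟨IsAffineOn.transpose, IsAffineOn.transpose⟩

/-- `f` is affine on all rectangles of the grid given by `Tv` and `Th`. -/
def IsGridFor (f : Equiv.Perm Square) (Tv Th : BinaryTree Unit) : Prop :=
  ∀ I ∈ leafIntervals Tv, ∀ J ∈ leafIntervals Th, IsAffineOn f (I, J)

theorem IsGridFor.transpose {f : Equiv.Perm Square} {Tv Th : BinaryTree Unit}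
    (h : IsGridFor f Tv Th) : IsGridFor (transpose f) Th Tv :=
  fun J hJ I hI => (h I hI J hJ).transpose

theorem leafRects_paint_horiz (T : BinaryTree Unit) :
    leafRects (paint .horiz T) = (leafIntervals T).map fun J => ([], J) := by
  induction T with
  | nil => rfl
  | node u l r ihl ihr =>
    change (leafRects (paint .horiz l)).map _ ++ (leafRects (paint .horiz r)).map _ = _
    simp only [ihl, ihr, leafIntervals, List.map_append, List.map_map, Function.comp_def,
      Caret.child]

theorem leafRects_gridTree (Tv Th : BinaryTree Unit) :
    leafRects (gridTree Tv Th) =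
      (leafIntervals Tv).flatMap fun I => (leafIntervals Th).map fun J => (I, J) := by
  induction Tv with
  | nil => exact (leafRects_paint_horiz Th).trans (List.flatMap_singleton _ _).symm
  | node u l r ihl ihr =>
    change (leafRects (gridTree l Th)).map _ ++ (leafRects (gridTree r Th)).map _ = _
    simp only [ihl, ihr, leafIntervals, List.flatMap_append, List.flatMap_map, List.map_flatMap,
      List.map_map, Function.comp_def, Caret.child]

theorem mem_leafRects_gridTree {Tv Th : BinaryTree Unit} {I J : List Bool} :
    (I, J) ∈ leafRects (gridTree Tv Th) ↔ I ∈ leafIntervals Tv ∧ J ∈ leafIntervals Th := by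
  simp [leafRects_gridTree]

theorem GridDiagram.Represents.isGridFor {D : GridDiagram} {f : Equiv.Perm Square}
    (h : D.Represents f) : IsGridFor f D.Tv D.Th := by
  intro I hI J hJ
  obtain ⟨p, hp, hr⟩ := List.getElem_of_mem (mem_leafRects_gridTree.2 ⟨hI, hJ⟩)
  have haffine := List.Forall₂.get h hp (h.length_eq ▸ hp)
  rw [List.get_eq_getElem, hr] at haffine
  exact ⟨_, haffine⟩

theorem GridDiagram.Represents.ext {D D' : GridDiagram} {f : Equiv.Perm Square}
    (h : D.Represents f) (h' : D'.Represents f) (hv : D.Tv = D'.Tv) (hh : D.Th = D'.Th) :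
    D = D' := by
  obtain ⟨Tv, Th, t, _, _⟩ := D
  obtain ⟨Tv', Th', t', _, _⟩ := D'
  obtain rfl : Tv = Tv' := hv
  obtain rfl : Th = Th' := hh
  have hunique : Relator.RightUnique (MapsRect f) := fun _ _ _ => MapsRect.unique
  obtain rfl : t = t' := hunique.forall₂ h h'
  rfl

theorem IsGridFor.exists_diagram {f : Equiv.Perm Square} {Tv Th : BinaryTree Unit}
    (h : IsGridFor f Tv Th) : ∃ D : GridDiagram, D.Represents f ∧ D.Tv = Tv ∧ D.Th = Th := by
  have haffine : ∀ r ∈ leafRects (gridTree Tv Th), ∃ r', MapsRect f r r' := fun r hr =>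
    have hmem := mem_leafRects_gridTree.1 hr
    h r.1 hmem.1 r.2 hmem.2
  choose! g hg using haffine
  have himage : List.Forall₂ (MapsRect f) (leafRects (gridTree Tv Th))
      ((leafRects (gridTree Tv Th)).map g) :=
    List.forall₂_map_right_iff.2 (List.forall₂_same.2 hg)
  exact ⟨⟨Tv, Th, _, List.length_map _, ((isTiling_leafRects _).image himage).exists_tree⟩,
    himage, rfl, rfl⟩

/-! ### Existence and uniqueness of the reduced diagram -/

theorem cons_mem_leafIntervals_node {u : Unit} {l r : BinaryTree Unit} {e : Bool}
    {I : List Bool} :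
    e :: I ∈ leafIntervals (.node u l r) ↔ I ∈ leafIntervals (bif e then r else l) := by
  cases e <;> simp [leafIntervals]

theorem nil_notMem_leafIntervals_node {u : Unit} {l r : BinaryTree Unit} :
    [] ∉ leafIntervals (.node u l r) := by
  simp [leafIntervals]

theorem exists_tree_forall_length_eq (N : ℕ) :
    ∃ T : BinaryTree Unit, ∀ I ∈ leafIntervals T, I.length = N := by
  induction N with
  | zero => exact ⟨.nil, fun I hI => by rw [List.mem_singleton.1 hI, List.length_nil]⟩
  | succ N ih =>
    obtain ⟨T, hT⟩ := ih
    refine ⟨.node () T T, fun I hI => ?_⟩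
    cases I with
    | nil => exact absurd hI nil_notMem_leafIntervals_node
    | cons e I =>
      have hmem := cons_mem_leafIntervals_node.1 hI
      rw [Bool.cond_self] at hmem
      rw [List.length_cons, hT I hmem]

theorem IsDyadic.exists_isGridFor {f : Equiv.Perm Square} (hf : IsDyadic f) :
    ∃ Tv Th, IsGridFor f Tv Th := by
  obtain ⟨s, hcover, haffine⟩ := hf
  let N : ℕ := s.sup fun r => max r.1.length r.2.length
  obtain ⟨T, hT⟩ := exists_tree_forall_length_eq N
  refine ⟨T, T, fun I hI J hJ => ?_⟩
  obtain ⟨q, hq, y, hy⟩ := hcover (Rect.place (I, J) (.const false, .const false))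
  have hN : max q.1.length q.2.length ≤ N :=
    Finset.le_sup (f := fun r : Rect => max r.1.length r.2.length) hq
  obtain ⟨u, rfl⟩ := exists_append_of_stream (congrArg Prod.fst hy)
    ((le_max_left _ _).trans (hN.trans_eq (hT I hI).symm))
  obtain ⟨v, rfl⟩ := exists_append_of_stream (congrArg Prod.snd hy)
    ((le_max_right _ _).trans (hN.trans_eq (hT J hJ).symm))
  exact IsAffineOn.append (haffine q hq) u v

/-- The tree obtained from `T` by erasing everything below the interval `I`, which thus becomes a
leaf; it is `T` itself if `I` lies inside a leaf of `T`. -/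
def prune : BinaryTree Unit → List Bool → BinaryTree Unit
  | .nil, _ => .nil
  | .node _ _ _, [] => .nil
  | .node u l r, false :: I => .node u (prune l I) r
  | .node u l r, true :: I => .node u l (prune r I)

theorem numNodes_prune_lt {T : BinaryTree Unit} {I : List Bool} {e : Bool}
    (h : I ++ [e] ∈ leafIntervals T) : (prune T I).numNodes < T.numNodes := by
  induction T generalizing I with
  | nil => simp [leafIntervals] at h
  | node u l r ihl ihr =>
    rcases I with _ | ⟨_ | _, I⟩
    · exact Nat.succ_pos _
    · have hlt := ihl (cons_mem_leafIntervals_node.1 h)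
      simp only [prune, BinaryTree.numNodes]
      omega
    · have hlt := ihr (cons_mem_leafIntervals_node.1 h)
      simp only [prune, BinaryTree.numNodes]
      omega

theorem eq_or_mem_of_mem_leafIntervals_prune {T : BinaryTree Unit} {I K : List Bool}
    (h : K ∈ leafIntervals (prune T I)) : K = I ∨ K ∈ leafIntervals T := by
  induction T generalizing I K with
  | nil => exact .inr h
  | node u l r ihl ihr =>
    rcases I with _ | ⟨d, I⟩
    · exact .inl (List.mem_singleton.1 h)
    rcases K with _ | ⟨e, K⟩
    · cases d <;> exact absurd h nil_notMem_leafIntervals_node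
    rw [cons_mem_leafIntervals_node]
    cases d <;> cases e <;> have hK := cons_mem_leafIntervals_node.1 h
    · exact (ihl hK).imp_left (congrArg _)
    · exact .inr hK
    · exact .inr hK
    · exact (ihr hK).imp_left (congrArg _)

theorem IsGridFor.prune_vert {f : Equiv.Perm Square} {Tv Th : BinaryTree Unit} {I : List Bool}
    (h : IsGridFor f Tv Th) (hI : ∀ J ∈ leafIntervals Th, IsAffineOn f (I, J)) :
    IsGridFor f (prune Tv I) Th := by
  intro K hK J hJ
  rcases eq_or_mem_of_mem_leafIntervals_prune hK with rfl | hK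
  exacts [hI J hJ, h K hK J hJ]

theorem IsGridFor.prune_horiz {f : Equiv.Perm Square} {Tv Th : BinaryTree Unit} {J : List Bool}
    (h : IsGridFor f Tv Th) (hJ : ∀ I ∈ leafIntervals Tv, IsAffineOn f (I, J)) :
    IsGridFor f Tv (prune Th J) :=
  (h.transpose.prune_vert fun I hI => (hJ I hI).transpose).transpose

theorem IsDyadic.exists_isReducedFor {f : Equiv.Perm Square} (hf : IsDyadic f) :
    ∃ D : GridDiagram, D.IsReducedFor f := by
  obtain ⟨Tv₀, Th₀, h₀⟩ := hf.exists_isGridFor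
  obtain ⟨⟨Tv, Th⟩, hmin⟩ := exists_minimalFor_of_wellFoundedLT
    (fun T : BinaryTree Unit × BinaryTree Unit => IsGridFor f T.1 T.2)
    (fun T => T.1.numNodes + T.2.numNodes) ⟨(Tv₀, Th₀), h₀⟩
  have hgrid : IsGridFor f Tv Th := hmin.1
  obtain ⟨D, hD, rfl, rfl⟩ := hgrid.exists_diagram
  refine ⟨D, hD, fun I hI _ => ?_, fun J hJ _ => ?_⟩ <;> by_contra! haffine
  · exact hmin.not_lt (j := (prune D.Tv I, D.Th)) (hgrid.prune_vert haffine)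
      (Nat.add_lt_add_right (numNodes_prune_lt hI) _)
  · exact hmin.not_lt (j := (D.Tv, prune D.Th J)) (hgrid.prune_horiz haffine)
      (Nat.add_lt_add_left (numNodes_prune_lt hJ) _)

theorem exists_prefix_or_exposed_caret (T : BinaryTree Unit) (u : List Bool) :
    (∃ I ∈ leafIntervals T, I <+: u) ∨ ∃ v, ∀ e, u ++ v ++ [e] ∈ leafIntervals T := by
  induction T generalizing u with
  | nil => exact .inl ⟨[], List.mem_singleton_self _, List.nil_prefix⟩
  | node c l r ihl ihr =>
    have ih (e : Bool) : ∀ u, (∃ I ∈ leafIntervals (bif e then r else l), I <+: u) ∨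
        ∃ v, ∀ d, u ++ v ++ [d] ∈ leafIntervals (bif e then r else l) := by
      cases e
      exacts [ihl, ihr]
    rcases u with _ | ⟨e, u⟩
    · right
      by_cases hexposed : ∃ e v, ∀ d, v ++ [d] ∈ leafIntervals (bif e then r else l)
      · obtain ⟨e, v, hv⟩ := hexposed
        exact ⟨e :: v, fun d => cons_mem_leafIntervals_node.2 (hv d)⟩
      · refine ⟨[], fun e => cons_mem_leafIntervals_node.2 ?_⟩
        obtain ⟨I, hI, hnil⟩ := (ih e []).resolve_right fun ⟨v, hv⟩ => hexposed ⟨e, v, hv⟩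
        rwa [List.prefix_nil.1 hnil] at hI
    · rcases ih e u with ⟨I, hI, hp⟩ | ⟨v, hv⟩
      · exact .inl ⟨e :: I, cons_mem_leafIntervals_node.2 hI, (List.prefix_cons_inj e).2 hp⟩
      · exact .inr ⟨v, fun d => cons_mem_leafIntervals_node.2 (hv d)⟩

/-- Every leaf interval of `T'` lies in a leaf interval of `T`. -/
def Refines (T' T : BinaryTree Unit) : Prop :=
  ∀ I' ∈ leafIntervals T', ∃ I ∈ leafIntervals T, I <+: I'

theorem Refines.child {u u' : Unit} {l r l' r' : BinaryTree Unit}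
    (h : Refines (.node u l r) (.node u' l' r')) (e : Bool) :
    Refines (bif e then r else l) (bif e then r' else l') := by
  intro I hI
  obtain ⟨K, hK, hp⟩ := h (e :: I) (cons_mem_leafIntervals_node.2 hI)
  rcases K with _ | ⟨d, K⟩
  · exact absurd hK nil_notMem_leafIntervals_node
  obtain ⟨rfl, hKI⟩ := List.cons_prefix_cons.1 hp
  exact ⟨K, cons_mem_leafIntervals_node.1 hK, hKI⟩

theorem not_refines_nil_node {u : Unit} {l r : BinaryTree Unit} :
    ¬ Refines .nil (.node u l r) := by
  intro h
  obtain ⟨K, hK, hnil⟩ := h [] (List.mem_singleton_self _)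
  rw [List.prefix_nil.1 hnil] at hK
  exact nil_notMem_leafIntervals_node hK

theorem Refines.antisymm {T T' : BinaryTree Unit} (h : Refines T T') (h' : Refines T' T) :
    T = T' := by
  induction T generalizing T' with
  | nil =>
    cases T' with
    | nil => rfl
    | node => exact absurd h not_refines_nil_node
  | node u l r ihl ihr =>
    cases T' with
    | nil => exact absurd h' not_refines_nil_node
    | node =>
      obtain rfl := ihl (h.child false) (h'.child false)
      obtain rfl := ihr (h.child true) (h'.child true)
      rfl

theorem IsGridFor.refines {f : Equiv.Perm Square} {Tv Th Tv' Th' : BinaryTree Unit}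
    (h : IsGridFor f Tv Th) (h' : IsGridFor f Tv' Th')
    (hred : ∀ I, I ++ [false] ∈ leafIntervals Tv → I ++ [true] ∈ leafIntervals Tv →
      ∃ J ∈ leafIntervals Th, ¬ IsAffineOn f (I, J)) : Refines Tv' Tv := by
  intro I' hI'
  refine (exists_prefix_or_exposed_caret Tv I').resolve_right fun ⟨v, hv⟩ => ?_
  obtain ⟨J, hJ, hnot⟩ := hred (I' ++ v) (hv false) (hv true)
  apply hnot
  rcases exists_prefix_or_exposed_caret Th' J with ⟨J', hJ', w, rfl⟩ | ⟨w, hw⟩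
  · exact (h' I' hI' J' hJ').append v w
  · refine isAffineOn_of_vertical_halves (v := w ++ [false]) (fun e => h _ (hv e) J hJ) ?_
    simpa only [List.append_nil, List.append_assoc] using (h' I' hI' _ (hw false)).append v []

theorem GridDiagram.IsReducedFor.refines_Tv {D : GridDiagram} {f : Equiv.Perm Square}
    (hD : D.IsReducedFor f) {Tv Th : BinaryTree Unit} (h : IsGridFor f Tv Th) :
    Refines Tv D.Tv :=
  hD.1.isGridFor.refines h hD.2.1

theorem GridDiagram.IsReducedFor.refines_Th {D : GridDiagram} {f : Equiv.Perm Square}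
    (hD : D.IsReducedFor f) {Tv Th : BinaryTree Unit} (h : IsGridFor f Tv Th) :
    Refines Th D.Th := by
  refine hD.1.isGridFor.transpose.refines h.transpose fun J h₀ h₁ => ?_
  obtain ⟨I, hI, hnot⟩ := hD.2.2 J h₀ h₁
  exact ⟨I, hI, fun haffine => hnot (isAffineOn_transpose.1 haffine)⟩

theorem GridDiagram.IsReducedFor.unique {D D' : GridDiagram} {f : Equiv.Perm Square}
    (h : D.IsReducedFor f) (h' : D'.IsReducedFor f) : D = D' :=
  h.1.ext h'.1 ((h'.refines_Tv h.1.isGridFor).antisymm (h.refines_Tv h'.1.isGridFor))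
    ((h'.refines_Th h.1.isGridFor).antisymm (h.refines_Th h'.1.isGridFor))

theorem IsDyadic.existsUnique_isReducedFor {f : Equiv.Perm Square} (hf : IsDyadic f) :
    ∃! D : GridDiagram, D.IsReducedFor f :=
  let ⟨D, hD⟩ := hf.exists_isReducedFor
  ⟨D, hD, fun _ hD' => hD'.unique hD⟩

/-! ### Permutations of leaves and the normal form -/

theorem ofDiagram_trans {T S R : BinaryTree Caret} (σ : Fin T.numLeaves ≃ Fin S.numLeaves)
    (τ : Fin S.numLeaves ≃ Fin R.numLeaves) :
    (ofDiagram T S σ).trans (ofDiagram S R τ) = ofDiagram T R (σ.trans τ) := by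
  ext1 z
  simp only [ofDiagram, Equiv.trans_apply, Equiv.apply_symm_apply]
  rfl

theorem ofDiagram_symm {T S : BinaryTree Caret} (σ : Fin T.numLeaves ≃ Fin S.numLeaves) :
    (ofDiagram T S σ).symm = ofDiagram S T σ.symm :=
  rfl

theorem ofDiagram_refl (T : BinaryTree Caret) :
    ofDiagram T T (Equiv.refl _) = Equiv.refl Square := by
  ext1 z
  simp [ofDiagram]

theorem ofDiagram_locate_symm {T S : BinaryTree Caret} (σ : Fin T.numLeaves ≃ Fin S.numLeaves)
    (p : Fin T.numLeaves) (z : Square) :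
    ofDiagram T S σ ((locate T).symm (p, z)) = (locate S).symm (σ p, z) := by
  simp [ofDiagram]

theorem eq_ofDiagram {f : Equiv.Perm Square} {T S : BinaryTree Caret}
    {σ : Fin T.numLeaves ≃ Fin S.numLeaves}
    (h : ∀ p z, f ((locate T).symm (p, z)) = (locate S).symm (σ p, z)) : f = ofDiagram T S σ := by
  ext1 z
  obtain ⟨⟨p, x⟩, rfl⟩ := (locate T).symm.surjective z
  rw [h, ofDiagram_locate_symm]

theorem ofPerm_one (k : ℕ) : ofPerm k 1 = Equiv.refl Square :=
  ofDiagram_refl (allRight k)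

theorem ofPerm_mul (k : ℕ) (σ τ : Equiv.Perm (Fin (k + 1))) :
    ofPerm k (σ * τ) = (ofPerm k τ).trans (ofPerm k σ) := by
  rw [ofPerm, ofPerm, ofPerm, ofDiagram_trans]
  rfl

theorem ofPerm_allRightLeaf (k : ℕ) (σ : Equiv.Perm (Fin (k + 1))) (p : Fin (k + 1))
    (z : Square) : ofPerm k σ (allRightLeaf k p z) = allRightLeaf k (σ p) z := by
  have h := ofDiagram_locate_symm
    (((finCongr (numLeaves_allRight k)).trans σ).trans (finCongr (numLeaves_allRight k).symm))
    (finCongr (numLeaves_allRight k).symm p) z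
  rw [locate_symm_allRight, locate_symm_allRight] at h
  exact h

theorem ofPerm_swap_spineLeaf {i k j : ℕ} (hk : i + 2 ≤ k) (hj : j < k) (z : Square) :
    ofPerm k (Equiv.swap ⟨i, by omega⟩ ⟨i + 1, by omega⟩) (spineLeaf j z) =
      spineLeaf (Equiv.swap i (i + 1) j) z := by
  have h := ofPerm_allRightLeaf k (Equiv.swap ⟨i, by omega⟩ ⟨i + 1, by omega⟩) ⟨j, by omega⟩ z
  rw [Fin.val_injective.map_swap] at h
  have hswap : Equiv.swap i (i + 1) j < k := by
    rw [Equiv.swap_apply_def]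
    split_ifs <;> omega
  rwa [allRightLeaf_of_lt hj, allRightLeaf_of_lt hswap] at h

theorem ofPerm_swap_spineTail {i k : ℕ} (hk : i + 2 ≤ k) (z : Square) :
    ofPerm k (Equiv.swap ⟨i, by omega⟩ ⟨i + 1, by omega⟩) (spineTail (i + 2) z) =
      spineTail (i + 2) z := by
  obtain ⟨d, rfl⟩ := Nat.exists_eq_add_of_le hk
  rcases exists_eq_spineLeaf_or_eq_spineTail d z with ⟨j, hj, x, rfl⟩ | ⟨x, rfl⟩
  · rw [spineTail_spineLeaf, ofPerm_swap_spineLeaf hk (by omega),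
      Equiv.swap_apply_of_ne_of_ne (by omega) (by omega)]
  · rw [← spineTail_add, ← allRightLeaf_self]
    refine (ofPerm_allRightLeaf _ _ (Fin.last _) x).trans ?_
    rw [Equiv.swap_apply_of_ne_of_ne (Fin.ne_of_val_ne (show i + 2 + d ≠ i by omega))
      (Fin.ne_of_val_ne (show i + 2 + d ≠ i + 1 by omega))]
    rfl

theorem P_val_eq_ofPerm {i k : ℕ} (hk : i + 2 ≤ k) :
    (Letter.P i).val = ofPerm k (Equiv.swap ⟨i, by omega⟩ ⟨i + 1, by omega⟩) := by
  ext1 z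
  rcases exists_eq_spineLeaf_or_eq_spineTail (i + 2) z with ⟨j, hj, x, rfl⟩ | ⟨x, rfl⟩
  · exact (ofPerm_swap_spineLeaf le_rfl hj x).trans
      (ofPerm_swap_spineLeaf hk (hj.trans_le hk) x).symm
  · exact (ofPerm_swap_spineTail le_rfl x).trans (ofPerm_swap_spineTail hk x).symm

theorem exists_permutationWord (k : ℕ) (σ : Equiv.Perm (Fin (k + 1))) :
    ∃ w, IsPermutationWord w ∧ eval w = ofPerm k σ := by
  have hσ : σ ∈ Submonoid.closure (Set.range fun i : Fin k => Equiv.swap i.castSucc i.succ) := by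
    rw [Equiv.Perm.mclosure_swap_castSucc_succ]
    trivial
  induction hσ using Submonoid.closure_induction with
  | mem τ hτ =>
    obtain ⟨⟨i, hi⟩, rfl⟩ := hτ
    rcases Nat.eq_or_lt_of_le (Nat.succ_le_of_lt hi) with rfl | hik
    · exact ⟨[.Pbar i], List.forall_mem_singleton.2 ⟨i, .inr rfl⟩, rfl⟩
    · exact ⟨[.P i], List.forall_mem_singleton.2 ⟨i, .inl rfl⟩, P_val_eq_ofPerm hik⟩
  | one => exact ⟨[], List.forall_mem_nil _, (ofPerm_one k).symm⟩
  | mul σ τ _ _ hσ hτ =>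
    obtain ⟨w, hw, h⟩ := hσ
    obtain ⟨w', hw', h'⟩ := hτ
    exact ⟨w' ++ w, List.forall_mem_append.2 ⟨hw', hw⟩, by rw [eval_append, h, h', ofPerm_mul]⟩

theorem exists_eq_ofDiagram {f : Equiv.Perm Square} {T S : BinaryTree Caret} {L : List Rect}
    (h : List.Forall₂ (MapsRect f) (leafRects T) L) (hL : L.Perm (leafRects S)) :
    ∃ σ : Fin T.numLeaves ≃ Fin S.numLeaves, f = ofDiagram T S σ := by
  have hTL : T.numLeaves = L.length := (length_leafRects T).symm.trans h.length_eq
  let e : Fin L.length ≃ Fin (leafRects S).length :=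
    ⟨hL.idxBij, hL.symm.idxBij, hL.idxBij_symm_leftInverse_idxBij,
      hL.idxBij_leftInverse_idxBij_symm⟩
  refine ⟨((finCongr hTL).trans e).trans (finCongr (length_leafRects S)),
    eq_ofDiagram fun p z => ?_⟩
  have hp : (p : ℕ) < L.length := p.isLt.trans_eq hTL
  rw [locate_symm_apply, locate_symm_apply]
  exact (List.Forall₂.get h _ hp z).trans
    (congrArg (Rect.place · z) (hL.getElem_idxBij_eq_getElem ⟨p, hp⟩).symm)

theorem ofTree_eq_ofDiagram {T : BinaryTree Caret} {k : ℕ} (h : T.numLeaves = k + 1) :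
    ofTree T = ofDiagram T (allRight k) (finCongr (h.trans (numLeaves_allRight k).symm)) := by
  obtain rfl : T.numNodes = k := by
    rw [T.numLeaves_eq_numNodes_succ] at h
    exact Nat.succ_injective h
  rfl

theorem exists_ofDiagram_eq_trans {T S : BinaryTree Caret}
    (τ : Fin T.numLeaves ≃ Fin S.numLeaves) : ∃ σ : Equiv.Perm (Fin (S.numNodes + 1)),
      ofDiagram T S τ = ((ofTree T).trans (ofPerm S.numNodes σ)).trans (ofTree S).symm := by
  have hS := S.numLeaves_eq_numNodes_succ
  have hT : T.numLeaves = S.numNodes + 1 := (Fin.equiv_iff_eq.1 ⟨τ⟩).trans hS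
  refine ⟨((finCongr hT.symm).trans τ).trans (finCongr hS), ?_⟩
  rw [ofTree_eq_ofDiagram hT, ofTree_eq_ofDiagram hS, ofPerm, ofDiagram_symm, ofDiagram_trans,
    ofDiagram_trans]
  rfl

theorem GridDiagram.Represents.exists_normalForm {D : GridDiagram} {f : Equiv.Perm Square}
    (hD : D.Represents f) {S : BinaryTree Caret} (hS : D.target.Perm (leafRects S)) :
    ∃ (σ : Equiv.Perm (Fin (S.numNodes + 1))) (wP wN : List Letter),
      IsPermutationWord wP ∧ eval wP = ofPerm S.numNodes σ ∧
      IsStandardPositive wN ∧ eval wN = ofTree S ∧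
      f = ((eval (sourceWord D.Tv D.Th)).trans (eval wP)).trans (eval wN).symm := by
  obtain ⟨τ, hτ⟩ := exists_eq_ofDiagram hD hS
  obtain ⟨σ, hσ⟩ := exists_ofDiagram_eq_trans τ
  obtain ⟨wP, hwP, heval⟩ := exists_permutationWord S.numNodes σ
  refine ⟨σ, wP, treeWord S, hwP, heval, isStandardPositive_treeWord S, eval_treeWord S, ?_⟩
  rw [eval_sourceWord, heval, eval_treeWord, ← hσ, hτ]

/-! ### The prefix word of an element -/

theorem isGridWord_sourceWord (Tv Th : BinaryTree Unit) :
    IsGridWord Tv.numNodes Th.numNodes (sourceWord Tv Th) :=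
  ⟨_, _, _, _, _, rfl⟩

theorem eq_sourceWord {Tv Th : BinaryTree Unit} {w : List Letter}
    (hw : IsGridWord Tv.numNodes Th.numNodes w) (h : eval w = ofTree (gridTree Tv Th)) :
    w = sourceWord Tv Th :=
  eq_of_eval_eq_of_isGridWord hw (isGridWord_sourceWord Tv Th)
    (h.trans (eval_sourceWord Tv Th).symm)

theorem GridDiagram.IsReducedFor.isPrefixWord {D : GridDiagram} {f : Equiv.Perm Square}
    (hD : D.IsReducedFor f) : IsPrefixWord f (sourceWord D.Tv D.Th) :=
  ⟨D, hD, isGridWord_sourceWord _ _, eval_sourceWord _ _⟩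

theorem IsDyadic.existsUnique_isPrefixWord {f : Equiv.Perm Square} (hf : IsDyadic f) :
    ∃! w, IsPrefixWord f w := by
  obtain ⟨D, hD, huniq⟩ := hf.existsUnique_isReducedFor
  refine ⟨sourceWord D.Tv D.Th, hD.isPrefixWord, ?_⟩
  rintro w ⟨D', hD', hw, hval⟩
  obtain rfl := huniq D' hD'
  exact eq_sourceWord hw hval

end Thompson2V

open Thompson2V in
theorem mainTheorem4 (f : Equiv.Perm Square) (hf : f ∈ TwoV) :
    (∃! D : GridDiagram, D.IsReducedFor f) ∧
    (∃! w : List Letter, IsPrefixWord f w) ∧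
    ∀ D : GridDiagram, D.IsReducedFor f →
      ∀ n m : ℕ, D.Tv.numLeaves = n + 1 → D.Th.numLeaves = m + 1 →
      ∃ a b b' : ℕ → ℕ,
        -- the exponents are the leaf exponents
        a = spineExponent D.Tv ∧ b = spineExponent D.Th ∧ b' = interiorExponent D.Th ∧
        -- the word of the vertical tree, and its uniqueness
        eval (wordA n a) = ofTree (paint .vert D.Tv) ∧
        (∀ a₁ : ℕ → ℕ, eval (wordA n a₁) = ofTree (paint .vert D.Tv) → ∀ j ≤ n, a₁ j = a j) ∧
        -- the word of the horizontal tree on the spine, where the spine carets come from the `C`s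
        eval (wordC 0 (spineCarets D.Th) ++ wordB 0 m b) = ofTree (paint .horiz D.Th) ∧
        (∀ b₁ : ℕ → ℕ, eval (wordC 0 (spineCarets D.Th) ++ wordB 0 m b₁) =
          ofTree (paint .horiz D.Th) → ∀ p ≤ m, b₁ p = b p) ∧
        -- the word of the horizontal tree off the spine
        eval (wordB 0 m b') = ofTree (.node .vert (paint .horiz D.Th) .nil) ∧
        (∀ b₁ : ℕ → ℕ, eval (wordB 0 m b₁) = ofTree (.node .vert (paint .horiz D.Th) .nil) →
          ∀ p ≤ m, b₁ p = b' p) ∧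
        (∀ p ≤ m, b' p = b p ∨ b' p = b p + 1) ∧
        -- the word of the full source tree is the prefix word of `f`, and its uniqueness
        IsPrefixWord f (gridWord n m (spineCarets D.Tv) (spineCarets D.Th) a b b') ∧
        eval (gridWord n m (spineCarets D.Tv) (spineCarets D.Th) a b b') =
          ofTree (gridTree D.Tv D.Th) ∧
        (∀ w : List Letter, IsGridWord n m w → eval w = ofTree (gridTree D.Tv D.Th) →
          w = gridWord n m (spineCarets D.Tv) (spineCarets D.Th) a b b') ∧
        -- the normal form, for every tree of the target subdivision
        ∀ S : BinaryTree Caret, D.target.Perm (leafRects S) →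
          ∃ (σ : Equiv.Perm (Fin (S.numNodes + 1))) (wP wN : List Letter),
            IsPermutationWord wP ∧ eval wP = ofPerm S.numNodes σ ∧
            IsStandardPositive wN ∧ eval wN = ofTree S ∧
            f = ((eval (gridWord n m (spineCarets D.Tv) (spineCarets D.Th) a b b')).trans
              (eval wP)).trans (eval wN).symm := by
  refine ⟨hf.existsUnique_isReducedFor, hf.existsUnique_isPrefixWord, fun D hD n m hn hm => ?_⟩
  obtain rfl : D.Tv.numNodes = n :=
    Nat.succ_injective (D.Tv.numLeaves_eq_numNodes_succ.symm.trans hn)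
  obtain rfl : D.Th.numNodes = m :=
    Nat.succ_injective (D.Th.numLeaves_eq_numNodes_succ.symm.trans hm)
  have hA := eval_wordA_spineExponent D.Tv
  have hB := eval_wordC_append_wordB_spineExponent D.Th
  have hB' := eval_wordB_interiorExponent D.Th
  exact ⟨_, _, _, rfl, rfl, rfl,
    hA, fun _ h => exponents_eq_of_eval_wordA_eq (h.trans hA.symm),
    hB, fun _ h => exponents_eq_of_eval_wordB_eq (eval_append_left_cancel (h.trans hB.symm)),
    hB', fun _ h => exponents_eq_of_eval_wordB_eq (h.trans hB'.symm),
    fun p _ => interiorExponent_eq_or D.Th p,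
    hD.isPrefixWord, eval_sourceWord D.Tv D.Th, fun _ => eq_sourceWord,
    fun _ => hD.1.exists_normalForm⟩
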